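/- Let $H$ be a separable real Hilbert space with inner product $(\cdot,\cdot)$ and norm $\|\cdot\|$, and let $A\colon D(A)\subset H\to H$ be linear, densely defined, self-adjoint and positive definite with compact inverse. Let $(e_n)$ be an orthonormal basis of $H$ of eigenvectors of $A$, $Ae_n=\lambda_ne_n$, $\lambda_n>0$. For $r\in\mathbb R$ let $\dot H^r$ be the space of formal series $x=\sum_n x_ne_n$, $x_n\in\mathbb R$, with $\|x\|_r^2:=\sum_n\lambda_n^r x_n^2<\infty$ (so $\dot H^0=H$), let $A^{s}x=\sum_n\lambda_n^{s}x_ne_n$ and $E(t)x=e^{-tA}x=\sum_n e^{-\lambda_nt}x_ne_n$, and set $a(x,y)=(A^{1/2}x,A^{1/2}y)$ for $x,y\in\dot H^1$ and $\langle x,y\rangle=a(A^{-1}x,y)$ for $x\in\dot H^{-1}$, $y\in\dot H^1$. Let $(S_h)_{h\in(0,1]}$ be a family of finite-dimensional subspaces of $\dot H^1$. Define $R_h\colon\dot H^1\to S_h$, $P_h\colon\dot H^{-1}\to S_h$ and $A_h\colon S_h\to S_h$ by $$a(R_hx,y_h)=a(x,y_h),\qquad (P_hx,y_h)=\langle x,y_h\rangle,\qquad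 (A_hx_h,y_h)=a(x_h,y_h)\qquad\text{for all } y_h\in S_h.$$ Assume the approximation property: there is a constant $C$ such that $\|R_hx-x\|\le Ch^s\|x\|_s$ for all $s\in\{1,2\}$, $x\in\dot H^s$, $h\in(0,1]$. For $h,k\in(0,1]$ and $t\ge0$ let $E_{kh}(t)=(I+kA_h)^{-j}$ if $t\in[(j-1)k,jk)$, $j=1,2,\dots$ (implicit Euler scheme), and let $F_{kh}(t)=E_{kh}(t)P_h-E(t)$. Let $0\le\rho\le1$. (i) There is a constant $C$ such that, for all $x\in\dot H^{-\rho}$, $t>0$ and $h,k\in(0,1]$, the function $\sigma\mapsto F_{kh}(\sigma)x$ is Bochner integrable on $(0,t)$ and $$\Big\|\int_0^tF_{kh}(\sigma)x\,d\sigma\Big\|\le C\big(h^{2-\rho}+k^{\frac{2-\rho}{2}}\big)\|x\|_{-\rho}.$$ (ii) If, in addition, there is a constant $C'$ such that $\|P_hx\|_1\le C'\|x\|_1$ for all $x\in\dot H^1$, $h\in(0,1]$, then there is a constant $C$ such that, for all $x\in\dot H^{\rho}$, $t>0$ and $h,k\in(0,1]$, the function $\sigma\mapsto\|F_{kh}(\sigma)x\|^2$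 is integrable on $(0,t)$ and $$\Big(\int_0^t\|F_{kh}(\sigma)x\|^2\,d\sigma\Big)^{1/2}\le C\big(h^{1+\rho}+k^{\frac{1+\rho}{2}}\big)\|x\|_{\rho}.$$ -/

import Mathlib

open MeasureTheory
open scoped RealInnerProductSpace

noncomputable section

namespace GalerkinEuler

section Operator

universe u

variable {H : Type u} [NormedAddCommGroup H] [InnerProductSpace ℝ H] [CompleteSpace H]

/-- `A : D(A) ⊆ H → H` is densely defined, self-adjoint, positive definite and has a compact
(everywhere defined) inverse. -/
structure IsPosDefWithCompactInverse (A : H →ₗ.[ℝ] H) : Prop where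
  dense : Dense (A.domain : Set H)
  selfAdjoint : IsSelfAdjoint A
  pos : ∀ x : A.domain, (x : H) ≠ 0 → 0 < ⟪A x, (x : H)⟫
  compact_inverse : ∃ T : H →L[ℝ] H, IsCompactOperator T ∧
    (∀ x : H, ∃ hx : T x ∈ A.domain, A ⟨T x, hx⟩ = x) ∧ ∀ x : A.domain, T (A x) = (x : H)

/-- `e` is an orthonormal basis of eigenvectors of `A`, with `A (e n) = lam n • e n`. The index set
is arbitrary, so that finite-dimensional spaces are covered as well; `exists_eigenbasis` below shows
that such a basis exists for every operator as above. -/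
def IsEigenbasis {ι : Type*} (A : H →ₗ.[ℝ] H) (e : HilbertBasis ι ℝ H) (lam : ι → ℝ) : Prop :=
  ∀ n, ∃ hn : e n ∈ A.domain, A ⟨e n, hn⟩ = lam n • e n

theorem IsPosDefWithCompactInverse.eigenvalue_pos {ι : Type*} {A : H →ₗ.[ℝ] H}
    (hA : IsPosDefWithCompactInverse A) {e : HilbertBasis ι ℝ H} {lam : ι → ℝ}
    (he : IsEigenbasis A e lam) (n : ι) : 0 < lam n := by
  obtain ⟨hn, h⟩ := he n
  have h1 : ‖e n‖ = 1 := e.orthonormal.1 n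
  have h0 : e n ≠ 0 := by
    intro h0
    rw [h0, norm_zero] at h1
    exact zero_ne_one h1
  have := hA.pos ⟨e n, hn⟩ h0
  rw [h, real_inner_smul_left, real_inner_self_eq_norm_sq, h1] at this
  simpa using this

theorem IsPosDefWithCompactInverse.exists_eigenbasis {A : H →ₗ.[ℝ] H}
    (hA : IsPosDefWithCompactInverse A) :
    ∃ (ι : Type u) (e : HilbertBasis ι ℝ H) (lam : ι → ℝ), IsEigenbasis A e lam := by
  obtain ⟨T, hTc, hAT, -⟩ := hA.compact_inverse
  have hsymmA : ∀ x y : A.domain, ⟪A x, (y : H)⟫ = ⟪(x : H), A y⟫ := by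
    have h := LinearPMap.adjoint_isFormalAdjoint hA.dense
    rw [LinearPMap.isSelfAdjoint_def.mp hA.selfAdjoint] at h
    exact fun x y => h x y
  have hT : (T : H →ₗ[ℝ] H).IsSymmetric := by
    intro x y
    obtain ⟨hx, hx'⟩ := hAT x
    obtain ⟨hy, hy'⟩ := hAT y
    have := hsymmA ⟨T x, hx⟩ ⟨T y, hy⟩
    rw [hx', hy'] at this
    exact this.symm
  have hT0 : ∀ x, T x = 0 → x = 0 := by
    intro x hx
    obtain ⟨h1, h2⟩ := hAT x
    have : (⟨T x, h1⟩ : A.domain) = 0 := Subtype.ext hx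
    rw [this, LinearPMap.map_zero] at h2
    exact h2.symm
  have hVmem : ∀ μ x, x ∈ Module.End.eigenspace (T : H →ₗ[ℝ] H) μ ↔ T x = μ • x :=
    fun μ x => Module.End.mem_eigenspace_iff
  have hV : ∀ μ, CompleteSpace (Module.End.eigenspace (T : H →ₗ[ℝ] H) μ) := by
    intro μ
    have h : (Module.End.eigenspace (T : H →ₗ[ℝ] H) μ : Set H) = {x | T x = μ • x} :=
      Set.ext fun x => hVmem μ x
    have hc : IsClosed (Module.End.eigenspace (T : H →ₗ[ℝ] H) μ : Set H) := by
      rw [h]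
      exact isClosed_eq T.continuous (continuous_const_smul μ)
    exact hc.completeSpace_coe
  choose w b _ using fun μ => exists_hilbertBasis ℝ (Module.End.eigenspace (T : H →ₗ[ℝ] H) μ)
  have hon := hT.orthogonalFamily_eigenspaces.orthonormal_sigma_orthonormal
    (v_family := fun μ => (b μ : w μ → _)) (fun μ => (b μ).orthonormal)
  have hbot : (Submodule.span ℝ (Set.range fun a : Σ μ, w μ =>
      (Module.End.eigenspace (T : H →ₗ[ℝ] H) a.1).subtypeₗᵢ (b a.1 a.2)))ᗮ = ⊥ := by
    rw [Submodule.eq_bot_iff]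
    intro x hx
    have hle : (⨆ μ, Module.End.eigenspace (T : H →ₗ[ℝ] H) μ) ≤ (Submodule.span ℝ {x})ᗮ := by
      refine iSup_le fun μ v hv => ?_
      rw [Submodule.mem_orthogonal_singleton_iff_inner_right]
      have h1 := (b μ).hasSum_repr ⟨v, hv⟩
      have h2 := (h1.mapL (Submodule.subtypeL _)).mapL (innerSL ℝ x)
      refine h2.unique ?_
      convert hasSum_zero with n
      have h3 : ⟪x, ((b μ n : Module.End.eigenspace (T : H →ₗ[ℝ] H) μ) : H)⟫ = 0 := by
        rw [real_inner_comm]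
        exact hx _ (Submodule.subset_span ⟨⟨μ, n⟩, rfl⟩)
      simp [h3]
    have hx' : x ∈ (⨆ μ, Module.End.eigenspace (T : H →ₗ[ℝ] H) μ)ᗮ := by
      intro v hv
      rw [real_inner_comm]
      exact Submodule.mem_orthogonal_singleton_iff_inner_right.mp (hle hv)
    have h0 := ContinuousLinearMap.orthogonalComplement_iSup_eigenspaces_eq_bot hTc hT
    exact (Submodule.mem_bot ℝ).mp (h0 ▸ hx')
  refine ⟨_, HilbertBasis.mkOfOrthogonalEqBot hon hbot, fun a => a.1⁻¹, ?_⟩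
  rintro ⟨μ, v⟩
  rw [HilbertBasis.coe_mkOfOrthogonalEqBot]
  have hv : T (b μ v : H) = μ • (b μ v : H) := (hVmem μ _).mp (b μ v).2
  have hne : (b μ v : H) ≠ 0 := by
    intro h
    have : ‖(b μ v : H)‖ = 1 := (b μ).orthonormal.1 v
    rw [h, norm_zero] at this
    exact zero_ne_one this
  have hμ : μ ≠ 0 := by
    rintro rfl
    exact hne (hT0 _ (by simpa using hv))
  have hv' : T (μ⁻¹ • (b μ v : H)) = b μ v := by
    rw [map_smul, hv, smul_smul, inv_mul_cancel₀ hμ, one_smul]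
  obtain ⟨h1, h2⟩ := hAT (μ⁻¹ • (b μ v : H))
  have h3 : ((b μ v : Module.End.eigenspace (T : H →ₗ[ℝ] H) μ) : H) ∈ A.domain := hv' ▸ h1
  refine ⟨h3, ?_⟩
  have h4 : (⟨T (μ⁻¹ • (b μ v : H)), h1⟩ : A.domain) = ⟨(b μ v : H), h3⟩ := Subtype.ext hv'
  rw [h4] at h2
  exact h2

end Operator

section Spaces

variable {H : Type*} [NormedAddCommGroup H] [InnerProductSpace ℝ H] {ι : Type*}

/-- The coefficients `(x, e n)` of an element `x` of `H`. -/
def coeff (e : HilbertBasis ι ℝ H) (x : H) : ι → ℝ := fun n => ⟪e n, x⟫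

/-- The element `∑ x n • e n` of `H`, for a square-summable sequence of coefficients. -/
def toH (e : HilbertBasis ι ℝ H) (x : ι → ℝ) : H := ∑' n, x n • e n

/-- The space `Ḣ^r` of formal series `x = ∑ x n • e n` with `∑ (lam n)^r (x n)^2 < ∞`; a formal
series is represented by its coefficients. For `r ≥ 0` these are the `coeff e x`, for `x : H` in
the domain of `A^(r/2)`. -/
def Hdot (lam : ι → ℝ) (r : ℝ) : Set (ι → ℝ) := {x | Summable fun n => lam n ^ r * x n ^ 2}

/-- The norm `‖x‖_r` of `Ḣ^r`. -/
def hdotNorm (lam : ι → ℝ) (r : ℝ) (x : ι → ℝ) : ℝ := √(∑' n, lam n ^ r * x n ^ 2)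

/-- The power `A^s`, acting on formal series. -/
def fracPow (lam : ι → ℝ) (s : ℝ) (x : ι → ℝ) : ι → ℝ := fun n => lam n ^ s * x n

/-- The semigroup `E(t) = exp(-tA)`, for `t > 0`, applied to a formal series (if `x` belongs to `H`,
then also for `t = 0`). -/
def semigroup (e : HilbertBasis ι ℝ H) (lam : ι → ℝ) (t : ℝ) (x : ι → ℝ) : H :=
  toH e fun n => Real.exp (-lam n * t) * x n

/-- The bilinear form `a(x, y) = (A^(1/2) x, A^(1/2) y)` on `Ḣ^1`. -/
def formA (e : HilbertBasis ι ℝ H) (lam : ι → ℝ) (x y : ι → ℝ) : ℝ :=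
  ⟪toH e (fracPow lam (1 / 2) x), toH e (fracPow lam (1 / 2) y)⟫

/-- The duality pairing `⟨x, y⟩ = a(A⁻¹ x, y)` between `Ḣ^(-1)` and `Ḣ^1`. -/
def pairing (e : HilbertBasis ι ℝ H) (lam : ι → ℝ) (x y : ι → ℝ) : ℝ :=
  formA e lam (fracPow lam (-1) x) y

end Spaces

section Discrete

variable {H : Type*} [NormedAddCommGroup H] [InnerProductSpace ℝ H] {ι : Type*}

/-- `r = R_h x`, that is, `a(r, y) = a(x, y)` for all `y ∈ S_h`. -/
def IsRitzProjection (e : HilbertBasis ι ℝ H) (lam : ι → ℝ) (S : Submodule ℝ H) (x : ι → ℝ)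
    (r : S) : Prop :=
  ∀ y : S, formA e lam (coeff e r) (coeff e y) = formA e lam x (coeff e y)

/-- `p = P_h x`, that is, `(p, y) = ⟨x, y⟩` for all `y ∈ S_h`. -/
def IsGenProjection (e : HilbertBasis ι ℝ H) (lam : ι → ℝ) (S : Submodule ℝ H) (x : ι → ℝ)
    (p : S) : Prop :=
  ∀ y : S, ⟪(p : H), (y : H)⟫ = pairing e lam x (coeff e y)

/-- `B = A_h`, that is, `(B x, y) = a(x, y)` for all `x, y ∈ S_h`. -/
def IsDiscreteOperator (e : HilbertBasis ι ℝ H) (lam : ι → ℝ) (S : Submodule ℝ H)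
    (B : S →ₗ[ℝ] S) : Prop :=
  ∀ x y : S, ⟪(B x : H), (y : H)⟫ = formA e lam (coeff e x) (coeff e y)

/-- The Ritz projection `R_h : Ḣ^1 → S_h` (see `existsUnique_ritz`). -/
def ritz (e : HilbertBasis ι ℝ H) (lam : ι → ℝ) (S : Submodule ℝ H) (x : ι → ℝ) : S :=
  Classical.epsilon (IsRitzProjection e lam S x)

/-- The generalized orthogonal projection `P_h : Ḣ^(-1) → S_h` (see `existsUnique_genProj`). -/
def genProj (e : HilbertBasis ι ℝ H) (lam : ι → ℝ) (S : Submodule ℝ H) (x : ι → ℝ) : S :=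
  Classical.epsilon (IsGenProjection e lam S x)

/-- The discrete operator `A_h : S_h → S_h` (see `existsUnique_discreteOp`). -/
def discreteOp (e : HilbertBasis ι ℝ H) (lam : ι → ℝ) (S : Submodule ℝ H) : S →ₗ[ℝ] S :=
  Classical.epsilon (IsDiscreteOperator e lam S)

/-- One step `R(k A_h) = (I + k A_h)⁻¹` of the implicit Euler scheme, as an element of the ring of
endomorphisms of `S_h` (see `isUnit_one_add_smul_discreteOp`). -/
def eulerStep (e : HilbertBasis ι ℝ H) (lam : ι → ℝ) (S : Submodule ℝ H) (k : ℝ) :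
    Module.End ℝ S :=
  Ring.inverse (1 + k • (discreteOp e lam S : Module.End ℝ S))

/-- `E_kh(t) = R(k A_h)^j` for `t ∈ [t_{j-1}, t_j)`, `j = 1, 2, …`, where `t_j = j k`. -/
def eulerProp (e : HilbertBasis ι ℝ H) (lam : ι → ℝ) (S : Submodule ℝ H) (k t : ℝ) :
    Module.End ℝ S :=
  eulerStep e lam S k ^ (⌊t / k⌋₊ + 1)

/-- The error operator `F_kh(t) = E_kh(t) P_h - E(t)`. -/
def errorOp (e : HilbertBasis ι ℝ H) (lam : ι → ℝ) (S : Submodule ℝ H) (k t : ℝ) (x : ι → ℝ) : H :=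
  (eulerProp e lam S k t (genProj e lam S x) : H) - semigroup e lam t x

/-- `(S h)`, `h ∈ (0, 1]`, is a family of finite-dimensional subspaces of `Ḣ^1`. -/
def IsGalerkinFamily (e : HilbertBasis ι ℝ H) (lam : ι → ℝ) (S : ℝ → Submodule ℝ H) : Prop :=
  ∀ h ∈ Set.Ioc (0 : ℝ) 1, FiniteDimensional ℝ (S h) ∧ ∀ y ∈ S h, coeff e y ∈ Hdot lam 1

/-- The approximation property `‖R_h x - x‖ ≤ C h^s ‖x‖_s` for `s ∈ {1, 2}`. -/
def ApproximationProperty (e : HilbertBasis ι ℝ H) (lam : ι → ℝ) (S : ℝ → Submodule ℝ H) : Prop :=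
  ∃ C : ℝ, ∀ h ∈ Set.Ioc (0 : ℝ) 1, ∀ s ∈ ({1, 2} : Set ℝ), ∀ x ∈ Hdot lam s,
    ‖(ritz e lam (S h) x : H) - toH e x‖ ≤ C * h ^ s * hdotNorm lam s x

/-- The stability `‖P_h x‖_1 ≤ C ‖x‖_1` of the orthogonal projections. -/
def ProjectionStability (e : HilbertBasis ι ℝ H) (lam : ι → ℝ) (S : ℝ → Submodule ℝ H) : Prop :=
  ∃ C : ℝ, ∀ h ∈ Set.Ioc (0 : ℝ) 1, ∀ x ∈ Hdot lam 1,
    hdotNorm lam 1 (coeff e (genProj e lam (S h) x : H)) ≤ C * hdotNorm lam 1 x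

end Discrete

section WellDefined

variable {H : Type*} [NormedAddCommGroup H] [InnerProductSpace ℝ H] {ι : Type*}
  {e : HilbertBasis ι ℝ H} {lam : ι → ℝ} {S : Submodule ℝ H}

theorem hasSum_toH {x : ι → ℝ} (hx : Summable fun n => x n ^ 2) :
    HasSum (fun n => x n • e n) (toH e x) := by
  have hm : Memℓp x 2 := by
    refine memℓp_gen ?_
    simpa using hx
  exact (e.hasSum_repr_symm ⟨x, hm⟩).summable.hasSum

theorem coeff_toH {x : ι → ℝ} (hx : Summable fun n => x n ^ 2) : coeff e (toH e x) = x := by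
  have hm : Memℓp x 2 := by
    refine memℓp_gen ?_
    simpa using hx
  have h : toH e x = e.repr.symm ⟨x, hm⟩ := (e.hasSum_repr_symm ⟨x, hm⟩).tsum_eq
  funext n
  rw [h, coeff, ← e.repr_apply_apply]
  simp

theorem toH_coeff (x : H) : toH e (coeff e x) = x := by
  have h := e.hasSum_repr x
  simp only [e.repr_apply_apply] at h
  exact h.tsum_eq

theorem summable_half (hlam : ∀ n, 0 < lam n) {x : ι → ℝ}
    (hx : x ∈ Hdot lam 1) : Summable fun n => fracPow lam (1 / 2) x n ^ 2 := by
  refine Summable.congr hx fun n => ?_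
  rw [fracPow, mul_pow, ← Real.rpow_mul_natCast (hlam n).le]
  norm_num

/-- The linear map `A^(1/2)` on `S_h`. -/
def sqrtOn (hlam : ∀ n, 0 < lam n) (hS : ∀ y ∈ S, coeff e y ∈ Hdot lam 1) : S →ₗ[ℝ] H where
  toFun y := toH e (fracPow lam (1 / 2) (coeff e y))
  map_add' y z := by
    have h1 := hasSum_toH (e := e) (summable_half hlam (hS y y.2))
    have h2 := hasSum_toH (e := e) (summable_half hlam (hS z z.2))
    have h3 := hasSum_toH (e := e) (summable_half hlam (hS _ (y + z).2))
    refine h3.unique ?_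
    convert h1.add h2 using 2 with n
    simp only [fracPow, coeff, Submodule.coe_add, inner_add_right, mul_add, add_smul]
  map_smul' c y := by
    have h1 := hasSum_toH (e := e) (summable_half hlam (hS y y.2))
    have h3 := hasSum_toH (e := e) (summable_half hlam (hS _ (c • y).2))
    refine h3.unique ?_
    rw [RingHom.id_apply]
    convert h1.const_smul c using 2 with n
    simp only [fracPow, coeff, Submodule.coe_smul, inner_smul_right, smul_smul]
    congr 1
    ring

theorem sqrtOn_injective (hlam : ∀ n, 0 < lam n) (hS : ∀ y ∈ S, coeff e y ∈ Hdot lam 1) (y : S)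
    (hy : sqrtOn hlam hS y = 0) : y = 0 := by
  have h1 := coeff_toH (e := e) (summable_half hlam (hS y y.2))
  have h2 : toH e (fracPow lam (1 / 2) (coeff e (y : H))) = 0 := hy
  rw [h2] at h1
  have h3 : coeff e (y : H) = 0 := by
    funext n
    have := congrFun h1 n
    simp only [coeff, inner_zero_right, fracPow] at this
    exact (mul_eq_zero.mp this.symm).resolve_left (Real.rpow_pos_of_pos (hlam n) _).ne'
  have h4 := toH_coeff (e := e) (y : H)
  rw [h3] at h4
  exact Subtype.ext (by simpa [toH] using h4.symm)

theorem existsUnique_riesz [FiniteDimensional ℝ S] (l : S →ₗ[ℝ] ℝ) :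
    ∃! p : S, ∀ y : S, ⟪(p : H), (y : H)⟫ = l y := by
  refine ⟨(InnerProductSpace.toDual ℝ S).symm l.toContinuousLinearMap, fun y => ?_, fun q hq => ?_⟩
  · rw [← Submodule.coe_inner, InnerProductSpace.toDual_symm_apply]
    rfl
  · refine ext_inner_right ℝ fun y => ?_
    rw [InnerProductSpace.toDual_symm_apply, Submodule.coe_inner, hq y]
    rfl

theorem existsUnique_genProj [FiniteDimensional ℝ S] (hlam : ∀ n, 0 < lam n)
    (hS : ∀ y ∈ S, coeff e y ∈ Hdot lam 1) (x : ι → ℝ) : ∃! p : S, IsGenProjection e lam S x p :=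
  existsUnique_riesz ((innerₛₗ ℝ (toH e (fracPow lam (1 / 2) (fracPow lam (-1) x)))).comp
    (sqrtOn hlam hS))

theorem existsUnique_discreteOp [FiniteDimensional ℝ S] (hlam : ∀ n, 0 < lam n)
    (hS : ∀ y ∈ S, coeff e y ∈ Hdot lam 1) : ∃! B : S →ₗ[ℝ] S, IsDiscreteOperator e lam S B := by
  choose f hf hf' using fun x : S =>
    existsUnique_riesz ((innerₛₗ ℝ (sqrtOn hlam hS x)).comp (sqrtOn hlam hS))
  have hf : ∀ x y : S, ⟪(f x : H), (y : H)⟫ = ⟪sqrtOn hlam hS x, sqrtOn hlam hS y⟫ := hf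
  refine ⟨⟨⟨f, fun x z => ?_⟩, fun c x => ?_⟩, fun x y => hf x y, fun B hB => ?_⟩
  · refine ext_inner_right ℝ fun y => ?_
    rw [Submodule.coe_inner, hf, inner_add_left, Submodule.coe_inner, Submodule.coe_inner, hf, hf,
      map_add, inner_add_left]
  · refine ext_inner_right ℝ fun y => ?_
    rw [Submodule.coe_inner, hf, RingHom.id_apply, real_inner_smul_left, Submodule.coe_inner, hf,
      map_smul, real_inner_smul_left]
  · ext1 x
    exact hf' x (B x) fun y => hB x y

theorem discreteOp_spec [FiniteDimensional ℝ S] (hlam : ∀ n, 0 < lam n)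
    (hS : ∀ y ∈ S, coeff e y ∈ Hdot lam 1) : IsDiscreteOperator e lam S (discreteOp e lam S) :=
  Classical.epsilon_spec (existsUnique_discreteOp hlam hS).exists

theorem inner_discreteOp_self [FiniteDimensional ℝ S] (hlam : ∀ n, 0 < lam n)
    (hS : ∀ y ∈ S, coeff e y ∈ Hdot lam 1) (x : S) :
    ⟪(discreteOp e lam S x : H), (x : H)⟫ = ‖sqrtOn hlam hS x‖ ^ 2 := by
  rw [discreteOp_spec hlam hS x x, ← real_inner_self_eq_norm_sq]
  rfl

theorem existsUnique_ritz [FiniteDimensional ℝ S] (hlam : ∀ n, 0 < lam n)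
    (hS : ∀ y ∈ S, coeff e y ∈ Hdot lam 1) (x : ι → ℝ) : ∃! r : S, IsRitzProjection e lam S x r := by
  have hinj : Function.Injective (discreteOp e lam S) := by
    rw [injective_iff_map_eq_zero]
    intro y hy
    have h := inner_discreteOp_self hlam hS y
    rw [hy, Submodule.coe_zero, inner_zero_left] at h
    exact sqrtOn_injective hlam hS y (by simpa using h.symm)
  obtain ⟨p, hp, -⟩ := existsUnique_riesz
    ((innerₛₗ ℝ (toH e (fracPow lam (1 / 2) x))).comp (sqrtOn hlam hS))
  obtain ⟨r, rfl⟩ := LinearMap.injective_iff_surjective.mp hinj p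
  refine ⟨r, fun y => ?_, fun q hq => hinj (ext_inner_right ℝ fun y => ?_)⟩
  · rw [← discreteOp_spec hlam hS r y]
    exact hp y
  · rw [Submodule.coe_inner, Submodule.coe_inner, discreteOp_spec hlam hS q y, hq y]
    exact (hp y).symm

theorem isUnit_one_add_smul_discreteOp [FiniteDimensional ℝ S] (hlam : ∀ n, 0 < lam n)
    (hS : ∀ y ∈ S, coeff e y ∈ Hdot lam 1) {k : ℝ} (hk : 0 < k) :
    IsUnit (1 + k • (discreteOp e lam S : Module.End ℝ S)) := by
  rw [LinearMap.isUnit_iff_ker_eq_bot, LinearMap.ker_eq_bot']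
  intro y hy
  have h : (y : H) + k • (discreteOp e lam S y : H) = 0 := congrArg Subtype.val hy
  have h1 : ⟪(y : H) + k • (discreteOp e lam S y : H), (y : H)⟫ = 0 := by
    rw [h, inner_zero_left]
  rw [inner_add_left, real_inner_smul_left, inner_discreteOp_self hlam hS y,
    real_inner_self_eq_norm_sq] at h1
  have h2 : ‖(y : H)‖ ^ 2 = 0 := by
    have : 0 ≤ k * ‖sqrtOn hlam hS y‖ ^ 2 := by positivity
    nlinarith [sq_nonneg ‖(y : H)‖]
  exact Subtype.ext (by simpa using h2)

end WellDefined

end GalerkinEuler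

end

/-! Everything is compared after applying T = R_h A⁻¹ (`solutionOp`), a symmetric positive
semidefinite operator on all of H. Let U_j be the Euler iterates started at P_h x, u_j = E(jk)x and
e_j = U_j - u_j. Since T A_h is the identity on S_h and T P_h x = R_h A⁻¹x, summing the scheme gives
T U_j + k ∑_{i=1}^{j} U_i = R_h A⁻¹x. Inserting u_j yields the error equation T e_j + k ∑_{i=1}^{j}
e_i = G_j (`solutionOp_error`). The residual G_j is (R_h - I)A⁻¹(I - E(jk))x plus the error of the
right-endpoint rule for ∫ E(σ)x over (0, jk).

For (i), w_j = k ∑_{i=1}^{j} e_i solves an implicit Euler scheme with right-hand side G. An energy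
argument weighted by time (`norm_le_of_euler`) bounds w by the suprema of ‖G_j‖ and (j+1)‖G_{j+1} -
G_j‖. For (ii), differencing the error equation gives a scheme for e_j with right-hand side (G_{j+1}
- G_j)/k and T e_0 = 0, so the plain energy estimate (`sum_norm_sq_le_of_euler`) bounds ∑ ‖e_j‖².

In the eigenbasis, the bounds on G become scalar inequalities for e^(-λk), combined with the
approximation property interpolated to the exponents 2 - ρ and 1 + ρ (`approximation_interpolated`).
Passing from grid points to arbitrary t costs one more quadrature error in (i), and the variation of
the exact solution within a step in (ii). -/

noncomputable section

namespace GalerkinEuler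

/-! ### Formal series, the scale Ḣ^r and spectral multipliers. -/

section Coefficients

variable {H : Type*} [NormedAddCommGroup H] [InnerProductSpace ℝ H] {ι : Type*}
  {e : HilbertBasis ι ℝ H} {lam : ι → ℝ} {x y : ι → ℝ} {r r' : ℝ}

theorem mem_Hdot_zero : x ∈ Hdot lam 0 ↔ Summable fun n => x n ^ 2 := by
  simp [Hdot]

theorem toH_add (hx : Summable fun n => x n ^ 2) (hy : Summable fun n => y n ^ 2) :
    toH e (fun n => x n + y n) = toH e x + toH e y := by
  have h := (hasSum_toH (e := e) hx).add (hasSum_toH (e := e) hy)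
  simp only [← add_smul] at h
  exact h.tsum_eq

theorem toH_smul (c : ℝ) (hx : Summable fun n => x n ^ 2) :
    toH e (fun n => c * x n) = c • toH e x := by
  have h := (hasSum_toH (e := e) hx).const_smul c
  simp only [smul_smul] at h
  exact h.tsum_eq

theorem toH_sub (hx : Summable fun n => x n ^ 2) (hy : Summable fun n => y n ^ 2) :
    toH e (fun n => x n - y n) = toH e x - toH e y := by
  have h := (hasSum_toH (e := e) hx).sub (hasSum_toH (e := e) hy)
  simp only [← sub_smul] at h
  exact h.tsum_eq

theorem hasSum_inner_toH (hx : Summable fun n => x n ^ 2) (hy : Summable fun n => y n ^ 2) :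
    HasSum (fun n => x n * y n) ⟪toH e x, toH e y⟫ := by
  have h := e.hasSum_inner_mul_inner (toH e x) (toH e y)
  refine h.congr_fun fun n => ?_
  have h1 := congrFun (coeff_toH (e := e) hx) n
  have h2 := congrFun (coeff_toH (e := e) hy) n
  simp only [coeff] at h1 h2
  rw [real_inner_comm, h1, h2]

theorem summable_coeff_sq (f : H) : Summable fun n => coeff e f n ^ 2 := by
  refine (e.hasSum_inner_mul_inner f f).summable.congr fun n => ?_
  rw [coeff, real_inner_comm, sq]

theorem norm_toH (hx : Summable fun n => x n ^ 2) : ‖toH e x‖ = hdotNorm lam 0 x := by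
  have h := (hasSum_inner_toH (e := e) hx hx).tsum_eq
  rw [hdotNorm, ← Real.sqrt_sq (norm_nonneg (toH e x)), ← real_inner_self_eq_norm_sq, ← h]
  simp [sq]

theorem hdotNorm_nonneg : 0 ≤ hdotNorm lam r x := Real.sqrt_nonneg _

theorem hdotNorm_sq (hlam : ∀ n, 0 < lam n) :
    hdotNorm lam r x ^ 2 = ∑' n, lam n ^ r * x n ^ 2 :=
  Real.sq_sqrt (tsum_nonneg fun n => mul_nonneg (Real.rpow_nonneg (hlam n).le _) (sq_nonneg _))

theorem mul_mem_Hdot (hlam : ∀ n, 0 < lam n) {K : ℝ} {m : ι → ℝ}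
    (hm : ∀ n, lam n ^ r * m n ^ 2 ≤ K * lam n ^ r') (hx : x ∈ Hdot lam r') :
    (fun n => m n * x n) ∈ Hdot lam r := by
  refine Summable.of_nonneg_of_le (fun n => ?_) (fun n => ?_) (Summable.mul_left K hx)
  · exact mul_nonneg (Real.rpow_nonneg (hlam n).le _) (sq_nonneg _)
  · have := mul_le_mul_of_nonneg_right (hm n) (sq_nonneg (x n))
    calc _ = lam n ^ r * m n ^ 2 * x n ^ 2 := by ring
      _ ≤ _ := this
      _ = _ := by ring

/-- Exchanging the sums over j and n reduces a square-sum bound for a family of multipliers to a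
scalar inequality at each eigenvalue. The case N = 1 is the bound for a single multiplier. -/
theorem sum_hdotNorm_sq_le (hlam : ∀ n, 0 < lam n) {K : ℝ} {m : ℕ → ι → ℝ} {N : ℕ}
    (hm : ∀ n, ∑ j ∈ Finset.range N, lam n ^ r * m j n ^ 2 ≤ K * lam n ^ r')
    (hx : x ∈ Hdot lam r') :
    ∑ j ∈ Finset.range N, hdotNorm lam r (fun n => m j n * x n) ^ 2
      ≤ K * hdotNorm lam r' x ^ 2 := by
  have hs : ∀ j ∈ Finset.range N, (fun n => m j n * x n) ∈ Hdot lam r := fun j hj =>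
    mul_mem_Hdot hlam (fun n => (Finset.single_le_sum (f := fun j => lam n ^ r * m j n ^ 2)
      (fun i _ => mul_nonneg (Real.rpow_nonneg (hlam n).le _) (sq_nonneg _)) hj).trans (hm n)) hx
  simp only [hdotNorm_sq hlam]
  rw [← Summable.tsum_finsetSum hs, ← tsum_mul_left]
  refine Summable.tsum_le_tsum (fun n => ?_) (summable_sum hs) (Summable.mul_left K hx)
  have := mul_le_mul_of_nonneg_right (hm n) (sq_nonneg (x n))
  calc _ = (∑ j ∈ Finset.range N, lam n ^ r * m j n ^ 2) * x n ^ 2 := by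
        rw [Finset.sum_mul]; exact Finset.sum_congr rfl fun j _ => by ring
    _ ≤ _ := this
    _ = _ := by ring

theorem hdotNorm_mul_le (hlam : ∀ n, 0 < lam n) {K : ℝ} (hK : 0 ≤ K) {m : ι → ℝ}
    (hm : ∀ n, lam n ^ r * m n ^ 2 ≤ K ^ 2 * lam n ^ r') (hx : x ∈ Hdot lam r') :
    hdotNorm lam r (fun n => m n * x n) ≤ K * hdotNorm lam r' x := by
  have h := sum_hdotNorm_sq_le hlam (m := fun _ => m) (N := 1) (K := K ^ 2) (by simpa using hm) hx
  rw [Finset.sum_range_one, ← mul_pow] at h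
  exact (pow_le_pow_iff_left₀ hdotNorm_nonneg (mul_nonneg hK hdotNorm_nonneg) two_ne_zero).mp h

theorem Hdot_add (hlam : ∀ n, 0 < lam n) (hx : x ∈ Hdot lam r) (hy : y ∈ Hdot lam r) :
    (fun n => x n + y n) ∈ Hdot lam r := by
  refine Summable.of_nonneg_of_le (fun n => ?_) (fun n => ?_)
    ((Summable.mul_left 2 hx).add (Summable.mul_left 2 hy))
  · exact mul_nonneg (Real.rpow_nonneg (hlam n).le _) (sq_nonneg _)
  · have := mul_nonneg (Real.rpow_nonneg (hlam n).le r) (sq_nonneg (x n - y n))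
    nlinarith

theorem Hdot_smul (hlam : ∀ n, 0 < lam n) (c : ℝ) (hx : x ∈ Hdot lam r) :
    (fun n => c * x n) ∈ Hdot lam r :=
  mul_mem_Hdot hlam (K := c ^ 2) (fun n => by rw [mul_comm]) hx

theorem Hdot_sub (hlam : ∀ n, 0 < lam n) (hx : x ∈ Hdot lam r) (hy : y ∈ Hdot lam r) :
    (fun n => x n - y n) ∈ Hdot lam r := by
  have := Hdot_add hlam hx (Hdot_smul hlam (-1) hy)
  refine (congrArg (· ∈ Hdot lam r) (funext fun n => ?_)).mp this
  ring

/-- If the eigenvalues are bounded below, then the spaces `Ḣ^r` decrease in `r`. -/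
theorem Hdot_mono {c : ℝ} (hc : 0 < c) (hlam : ∀ n, c ≤ lam n) (hr : r ≤ r')
    (hx : x ∈ Hdot lam r') : x ∈ Hdot lam r := by
  have hpos : ∀ n, 0 < lam n := fun n => hc.trans_le (hlam n)
  have := mul_mem_Hdot (m := fun _ => 1) (r := r) (K := c ^ (r - r')) hpos (fun n => ?_) hx
  · simpa using this
  · rw [one_pow, mul_one]
    calc lam n ^ r = lam n ^ (r - r') * lam n ^ r' := by
          rw [← Real.rpow_add (hpos n), sub_add_cancel]
      _ ≤ _ := mul_le_mul_of_nonneg_right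
        (Real.rpow_le_rpow_of_nonpos hc (hlam n) (by linarith)) (Real.rpow_nonneg (hpos n).le _)

/-- The powers of `A` shift the scale of spaces. -/
theorem fracPow_mem_Hdot (hlam : ∀ n, 0 < lam n) {s : ℝ} (hx : x ∈ Hdot lam (r + 2 * s)) :
    fracPow lam s x ∈ Hdot lam r := by
  refine mul_mem_Hdot hlam (K := 1) (fun n => ?_) hx
  rw [← Real.rpow_mul_natCast (hlam n).le, ← Real.rpow_add (hlam n), one_mul]
  exact le_of_eq (congrArg _ (by push_cast; ring))

theorem formA_add_left (hlam : ∀ n, 0 < lam n) {z : ι → ℝ} (hx : x ∈ Hdot lam 1)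
    (hy : y ∈ Hdot lam 1) :
    formA e lam (fun n => x n + y n) z = formA e lam x z + formA e lam y z := by
  rw [formA, formA, formA, ← inner_add_left,
    ← toH_add (summable_half hlam hx) (summable_half hlam hy)]
  congr 2
  funext n
  exact mul_add _ _ _

theorem formA_smul_left (hlam : ∀ n, 0 < lam n) {z : ι → ℝ} (c : ℝ) (hx : x ∈ Hdot lam 1) :
    formA e lam (fun n => c * x n) z = c * formA e lam x z := by
  rw [formA, formA, ← real_inner_smul_left, ← toH_smul c (summable_half hlam hx)]
  congr 2
  funext n
  exact mul_left_comm _ _ _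

theorem formA_comm (x y : ι → ℝ) : formA e lam x y = formA e lam y x := real_inner_comm _ _

/-- `a(A⁻¹ f, y) = (f, y)` for `f` in `H` and `y` in `Ḣ^1`. -/
theorem formA_inv_coeff (hlam : ∀ n, 0 < lam n) {c : ℝ} (hc : 0 < c) (hlam' : ∀ n, c ≤ lam n)
    (f y : H) (hy : coeff e y ∈ Hdot lam 1) :
    formA e lam (fracPow lam (-1) (coeff e f)) (coeff e y) = ⟪f, y⟫ := by
  have hf : fracPow lam (-1) (coeff e f) ∈ Hdot lam 1 := by
    refine fracPow_mem_Hdot hlam (Hdot_mono hc hlam' (r' := 0) (by norm_num) ?_)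
    exact mem_Hdot_zero.mpr (summable_coeff_sq f)
  refine (hasSum_inner_toH (summable_half hlam hf) (summable_half hlam hy)).unique ?_
  refine (e.hasSum_inner_mul_inner f y).congr_fun fun n => ?_
  have h : lam n ^ (1 / 2 : ℝ) * lam n ^ (-1 : ℝ) * lam n ^ (1 / 2 : ℝ) = 1 := by
    rw [← Real.rpow_add (hlam n), ← Real.rpow_add (hlam n)]
    norm_num
  simp only [fracPow, coeff]
  rw [real_inner_comm (e n) f]
  linear_combination (⟪e n, f⟫ * ⟪e n, y⟫) * h

end Coefficients

/-! ### Ritz projection, discrete solution operator and Euler iterates. -/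

section DiscreteOperators

variable {H : Type*} [NormedAddCommGroup H] [InnerProductSpace ℝ H] {ι : Type*}
  {e : HilbertBasis ι ℝ H} {lam : ι → ℝ} {S : Submodule ℝ H} [FiniteDimensional ℝ S]
  {x y : ι → ℝ} {c k : ℝ}

theorem ritz_spec (hlam : ∀ n, 0 < lam n) (hS : ∀ y ∈ S, coeff e y ∈ Hdot lam 1) (x : ι → ℝ) :
    IsRitzProjection e lam S x (ritz e lam S x) :=
  Classical.epsilon_spec (existsUnique_ritz hlam hS x).exists

theorem ritz_eq (hlam : ∀ n, 0 < lam n) (hS : ∀ y ∈ S, coeff e y ∈ Hdot lam 1) {p : S}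
    (hp : IsRitzProjection e lam S x p) : ritz e lam S x = p :=
  (existsUnique_ritz hlam hS x).unique (ritz_spec hlam hS x) hp

theorem genProj_spec (hlam : ∀ n, 0 < lam n) (hS : ∀ y ∈ S, coeff e y ∈ Hdot lam 1) (x : ι → ℝ) :
    IsGenProjection e lam S x (genProj e lam S x) :=
  Classical.epsilon_spec (existsUnique_genProj hlam hS x).exists

theorem coeff_add (f g : H) : coeff e (f + g) = fun n => coeff e f n + coeff e g n :=
  funext fun _ => inner_add_right _ _ _

theorem coeff_smul (a : ℝ) (f : H) : coeff e (a • f) = fun n => a * coeff e f n :=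
  funext fun _ => real_inner_smul_right _ _ _

theorem ritz_add (hlam : ∀ n, 0 < lam n) (hS : ∀ y ∈ S, coeff e y ∈ Hdot lam 1)
    (hx : x ∈ Hdot lam 1) (hy : y ∈ Hdot lam 1) :
    ritz e lam S (fun n => x n + y n) = ritz e lam S x + ritz e lam S y := by
  refine ritz_eq hlam hS fun z => ?_
  rw [Submodule.coe_add, coeff_add, formA_add_left hlam (hS _ (Subtype.prop _))
    (hS _ (Subtype.prop _)), formA_add_left hlam hx hy, ritz_spec hlam hS x z,
    ritz_spec hlam hS y z]

theorem ritz_smul (hlam : ∀ n, 0 < lam n) (hS : ∀ y ∈ S, coeff e y ∈ Hdot lam 1) (a : ℝ)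
    (hx : x ∈ Hdot lam 1) : ritz e lam S (fun n => a * x n) = a • ritz e lam S x := by
  refine ritz_eq hlam hS fun z => ?_
  rw [Submodule.coe_smul, coeff_smul, formA_smul_left hlam a (hS _ (Subtype.prop _)),
    formA_smul_left hlam a hx, ritz_spec hlam hS x z]

theorem ritz_sub (hlam : ∀ n, 0 < lam n) (hS : ∀ y ∈ S, coeff e y ∈ Hdot lam 1)
    (hx : x ∈ Hdot lam 1) (hy : y ∈ Hdot lam 1) :
    ritz e lam S (fun n => x n - y n) = ritz e lam S x - ritz e lam S y := by
  have h := ritz_add hlam hS hx (Hdot_smul hlam (-1) hy)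
  rw [ritz_smul hlam hS (-1) hy, neg_one_smul, ← sub_eq_add_neg] at h
  rw [← h]
  exact congrArg _ (funext fun n => by ring)

theorem fracPow_neg_one_coeff_mem (hc : 0 < c) (hlam : ∀ n, c ≤ lam n) (f : H) :
    fracPow lam (-1) (coeff e f) ∈ Hdot lam 1 := by
  refine fracPow_mem_Hdot (fun n => hc.trans_le (hlam n)) (Hdot_mono hc hlam (r' := 0)
    (by norm_num) ?_)
  exact mem_Hdot_zero.mpr (summable_coeff_sq f)

/-- The discrete solution operator `R_h A⁻¹` of the stationary problem. -/
def solutionOp (S : Submodule ℝ H) [FiniteDimensional ℝ S] (hc : 0 < c) (hlam : ∀ n, c ≤ lam n)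
    (hS : ∀ y ∈ S, coeff e y ∈ Hdot lam 1) : H →ₗ[ℝ] H where
  toFun f := ritz e lam S (fracPow lam (-1) (coeff e f))
  map_add' f g := by
    rw [← Submodule.coe_add, ← ritz_add (fun n => hc.trans_le (hlam n)) hS
      (fracPow_neg_one_coeff_mem hc hlam f) (fracPow_neg_one_coeff_mem hc hlam g), coeff_add]
    exact congrArg _ (congrArg _ (funext fun n => mul_add _ _ _))
  map_smul' a f := by
    rw [RingHom.id_apply, ← Submodule.coe_smul, ← ritz_smul (fun n => hc.trans_le (hlam n)) hS a
      (fracPow_neg_one_coeff_mem hc hlam f), coeff_smul]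
    exact congrArg _ (congrArg _ (funext fun n => mul_left_comm _ _ _))

/-- Taking T f as test function in the definition of T g gives a(T g, T f) = (g, T f). Symmetry and
positivity of T follow at once. -/
theorem inner_solutionOp (hc : 0 < c) (hlam : ∀ n, c ≤ lam n)
    (hS : ∀ y ∈ S, coeff e y ∈ Hdot lam 1) (f g : H) :
    ⟪solutionOp S hc hlam hS f, g⟫ =
      formA e lam (coeff e (solutionOp S hc hlam hS g)) (coeff e (solutionOp S hc hlam hS f)) := by
  have hpos : ∀ n, 0 < lam n := fun n => hc.trans_le (hlam n)
  refine Eq.trans ?_ (ritz_spec hpos hS (fracPow lam (-1) (coeff e g))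
    (ritz e lam S (fracPow lam (-1) (coeff e f)))).symm
  rw [real_inner_comm]
  exact (formA_inv_coeff hpos hc hlam g _ (hS _ (Subtype.prop _))).symm

theorem solutionOp_symmetric (hc : 0 < c) (hlam : ∀ n, c ≤ lam n)
    (hS : ∀ y ∈ S, coeff e y ∈ Hdot lam 1) (f g : H) :
    ⟪solutionOp S hc hlam hS f, g⟫ = ⟪f, solutionOp S hc hlam hS g⟫ := by
  rw [inner_solutionOp, real_inner_comm, inner_solutionOp, formA_comm]

theorem solutionOp_nonneg (hc : 0 < c) (hlam : ∀ n, c ≤ lam n)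
    (hS : ∀ y ∈ S, coeff e y ∈ Hdot lam 1) (f : H) :
    0 ≤ ⟪solutionOp S hc hlam hS f, f⟫ := by
  rw [inner_solutionOp]
  exact real_inner_self_nonneg

theorem solutionOp_genProj (hc : 0 < c) (hlam : ∀ n, c ≤ lam n)
    (hS : ∀ y ∈ S, coeff e y ∈ Hdot lam 1) (x : ι → ℝ) :
    solutionOp S hc hlam hS (genProj e lam S x) = ritz e lam S (fracPow lam (-1) x) := by
  have hpos : ∀ n, 0 < lam n := fun n => hc.trans_le (hlam n)
  refine congrArg Subtype.val (ritz_eq hpos hS fun y => ?_)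
  rw [ritz_spec hpos hS, formA_inv_coeff hpos hc hlam _ _ (hS _ y.2)]
  exact (genProj_spec hpos hS x y).symm

theorem solutionOp_discreteOp (hc : 0 < c) (hlam : ∀ n, c ≤ lam n)
    (hS : ∀ y ∈ S, coeff e y ∈ Hdot lam 1) (z : S) :
    solutionOp S hc hlam hS (discreteOp e lam S z) = z := by
  have hpos : ∀ n, 0 < lam n := fun n => hc.trans_le (hlam n)
  refine congrArg Subtype.val (ritz_eq hpos hS fun y => ?_)
  rw [formA_inv_coeff hpos hc hlam _ _ (hS _ y.2), discreteOp_spec hpos hS z y]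

/-- The implicit Euler approximations with initial value `P_h x`. -/
def eulerSeq (e : HilbertBasis ι ℝ H) (lam : ι → ℝ) (S : Submodule ℝ H) (k : ℝ) (x : ι → ℝ)
    (j : ℕ) : S :=
  (eulerStep e lam S k ^ j) (genProj e lam S x)

theorem eulerSeq_succ (hlam : ∀ n, 0 < lam n) (hS : ∀ y ∈ S, coeff e y ∈ Hdot lam 1)
    (hk : 0 < k) (x : ι → ℝ) (j : ℕ) :
    eulerSeq e lam S k x (j + 1) + k • discreteOp e lam S (eulerSeq e lam S k x (j + 1)) =
      eulerSeq e lam S k x j := by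
  have h := Ring.mul_inverse_cancel _ (isUnit_one_add_smul_discreteOp (S := S) hlam hS hk)
  have h1 := LinearMap.congr_fun h (eulerSeq e lam S k x j)
  rw [eulerSeq, pow_succ']
  exact h1

/-- The scheme summed in time after T has cancelled A_h. Only T remains, and T also acts on the
exact solution, which lies outside S_h. -/
theorem solutionOp_eulerSeq (hc : 0 < c) (hlam : ∀ n, c ≤ lam n)
    (hS : ∀ y ∈ S, coeff e y ∈ Hdot lam 1) (hk : 0 < k) (x : ι → ℝ) (j : ℕ) :
    solutionOp S hc hlam hS (eulerSeq e lam S k x j) +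
        k • ∑ i ∈ Finset.range j, (eulerSeq e lam S k x (i + 1) : H) =
      ritz e lam S (fracPow lam (-1) x) := by
  induction j with
  | zero => simpa [eulerSeq] using solutionOp_genProj hc hlam hS x
  | succ j ih =>
    rw [← ih, ← eulerSeq_succ (fun n => hc.trans_le (hlam n)) hS hk x j, Finset.sum_range_succ,
      Submodule.coe_add, Submodule.coe_smul, map_add, map_smul, solutionOp_discreteOp, smul_add]
    abel

end DiscreteOperators

/-! ### Energy estimates for an abstract implicit Euler scheme. -/

section Energy

variable {H : Type*} [NormedAddCommGroup H] [InnerProductSpace ℝ H] {T : H →ₗ[ℝ] H} {k : ℝ}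

/-- The two sides differ by ⟪T (y - x), y - x⟫. -/
theorem half_energy_le (hsymm : ∀ x y, ⟪T x, y⟫ = ⟪x, T y⟫) (hpos : ∀ x, 0 ≤ ⟪T x, x⟫) (x y : H) :
    ⟪T y, y⟫ - ⟪T x, x⟫ ≤ 2 * ⟪T (y - x), y⟫ := by
  have h := hpos (y - x)
  have h1 : ⟪T y, x⟫ = ⟪T x, y⟫ := by rw [hsymm, real_inner_comm]
  simp only [map_sub, inner_sub_left, inner_sub_right] at h ⊢
  linarith

/-- The energy estimate for the implicit Euler scheme `T (w' - w) / k + w' = g`. -/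
theorem sum_norm_sq_le_of_euler (hsymm : ∀ x y, ⟪T x, y⟫ = ⟪x, T y⟫) (hpos : ∀ x, 0 ≤ ⟪T x, x⟫)
    (hk : 0 < k) {w g : ℕ → H} (hw0 : T (w 0) = 0)
    (hw : ∀ j, T (w (j + 1) - w j) + k • w (j + 1) = k • g j) (N : ℕ) :
    ∑ j ∈ Finset.range N, ‖w (j + 1)‖ ^ 2 ≤ ∑ j ∈ Finset.range N, ‖g j‖ ^ 2 := by
  -- The scheme is tested with w_{N+1}; keeping the energy ⟪T w_N, w_N⟫ on the left lets the
  -- induction telescope.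
  have key : k * ∑ j ∈ Finset.range N, ‖w (j + 1)‖ ^ 2 + ⟪T (w N), w N⟫
      ≤ k * ∑ j ∈ Finset.range N, ‖g j‖ ^ 2 := by
    induction N with
    | zero => simp [hw0]
    | succ N ih =>
      rw [Finset.sum_range_succ, Finset.sum_range_succ]
      have h1 := half_energy_le hsymm hpos (w N) (w (N + 1))
      have h2 := congrArg (fun z => ⟪z, w (N + 1)⟫) (hw N)
      simp only [inner_add_left, real_inner_smul_left, real_inner_self_eq_norm_sq] at h2
      have h3 := real_inner_le_norm (g N) (w (N + 1))
      have h4 : 2 * ⟪g N, w (N + 1)⟫ ≤ ‖g N‖ ^ 2 + ‖w (N + 1)‖ ^ 2 := by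
        nlinarith [sq_nonneg (‖g N‖ - ‖w (N + 1)‖)]
      have h5 := mul_le_mul_of_nonneg_left h4 hk.le
      linarith
  have h := hpos (w N)
  exact le_of_mul_le_mul_left (by linarith) hk

/-- The maximum norm estimate for the implicit Euler scheme `T (w' - w) / k + w' = G'`. -/
theorem norm_le_of_euler (hsymm : ∀ x y, ⟪T x, y⟫ = ⟪x, T y⟫) (hpos : ∀ x, 0 ≤ ⟪T x, x⟫)
    (hk : 0 < k) {w G : ℕ → H} {M : ℝ} (hw0 : w 0 = 0)
    (hw : ∀ j, T (w (j + 1) - w j) + k • w (j + 1) = k • G (j + 1))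
    (hG : ∀ j, ‖G j‖ ≤ M) (hG' : ∀ j : ℕ, (j + 1) * ‖G (j + 1) - G j‖ ≤ M) (N : ℕ) :
    ‖w N‖ ≤ 4 * M := by
  have hM : 0 ≤ M := (norm_nonneg _).trans (hG 0)
  have hsum : ∑ j ∈ Finset.range N, ‖w j‖ ^ 2 ≤ N * M ^ 2 := by
    have h := sum_norm_sq_le_of_euler hsymm hpos hk (g := fun j => G (j + 1))
      (by rw [hw0, map_zero]) hw N
    have h1 : ∑ j ∈ Finset.range N, ‖w j‖ ^ 2 ≤ ∑ j ∈ Finset.range N, ‖w (j + 1)‖ ^ 2 := by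
      have h2 := Finset.sum_range_succ (fun j => ‖w j‖ ^ 2) N
      rw [Finset.sum_range_succ'] at h2
      simp only [hw0, norm_zero] at h2
      nlinarith [sq_nonneg ‖w N‖]
    have h3 : ∑ j ∈ Finset.range N, ‖G (j + 1)‖ ^ 2 ≤ ∑ j ∈ Finset.range N, M ^ 2 :=
      Finset.sum_le_sum fun j _ => pow_le_pow_left₀ (norm_nonneg _) (hG _) 2
    rw [Finset.sum_const, Finset.card_range, nsmul_eq_mul] at h3
    linarith
  have hsum' : M * ∑ j ∈ Finset.range N, ‖w j‖ ≤ N * M ^ 2 := by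
    have h : ∑ j ∈ Finset.range N, 2 * (M * ‖w j‖)
        ≤ ∑ j ∈ Finset.range N, (M ^ 2 + ‖w j‖ ^ 2) :=
      Finset.sum_le_sum fun j _ => by nlinarith [sq_nonneg (M - ‖w j‖)]
    rw [Finset.sum_add_distrib, Finset.sum_const, Finset.card_range, nsmul_eq_mul,
      ← Finset.mul_sum, ← Finset.mul_sum] at h
    linarith
  -- Discrete form of integrating d/dt (t‖w‖²). The scheme is tested with w_{n+1} - w_n, weighted by
  -- n + 1, and G is summed by parts. The step leaves -2(n+1)⟪G_{n+1} - G_n, w_n⟫ - 2⟪G_n, w_n⟫, at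
  -- most 4M‖w_n‖.
  have key : ∀ n : ℕ, n * ‖w n‖ ^ 2 ≤ ∑ j ∈ Finset.range n, ‖w j‖ ^ 2 + 2 * n * ⟪G n, w n⟫
      + 4 * M * ∑ j ∈ Finset.range n, ‖w j‖ := by
    intro n
    induction n with
    | zero => simp
    | succ n ih =>
      rw [Finset.sum_range_succ, Finset.sum_range_succ]
      have h1 : ⟪w (n + 1), w (n + 1) - w n⟫ ≤ ⟪G (n + 1), w (n + 1) - w n⟫ := by
        have h2 := congrArg (fun z => ⟪z, w (n + 1) - w n⟫) (hw n)
        simp only [inner_add_left, real_inner_smul_left] at h2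
        exact le_of_mul_le_mul_left (by linarith [hpos (w (n + 1) - w n)]) hk
      have h3 : ‖w (n + 1)‖ ^ 2 - ‖w n‖ ^ 2 ≤ 2 * ⟪w (n + 1), w (n + 1) - w n⟫ := by
        rw [inner_sub_right, real_inner_self_eq_norm_sq]
        have := norm_sub_sq_real (w (n + 1)) (w n)
        nlinarith [sq_nonneg ‖w (n + 1) - w n‖]
      have h4 : -((n + 1) * ⟪G (n + 1) - G n, w n⟫) ≤ M * ‖w n‖ := by
        have h5 := neg_le_of_abs_le (abs_real_inner_le_norm (G (n + 1) - G n) (w n))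
        have h6 := mul_le_mul_of_nonneg_right (hG' n) (norm_nonneg (w n))
        have h7 : (0 : ℝ) ≤ n + 1 := by positivity
        nlinarith
      have h8 : -⟪G n, w n⟫ ≤ M * ‖w n‖ := by
        have h5 := neg_le_of_abs_le (abs_real_inner_le_norm (G n) (w n))
        have h6 := mul_le_mul_of_nonneg_right (hG n) (norm_nonneg (w n))
        linarith
      have h9 : ((n : ℝ) + 1) * (‖w (n + 1)‖ ^ 2 - ‖w n‖ ^ 2)
          ≤ (n + 1) * (2 * ⟪G (n + 1), w (n + 1) - w n⟫) :=
        mul_le_mul_of_nonneg_left (by linarith) (by positivity)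
      rw [inner_sub_right] at h9
      rw [inner_sub_left] at h4
      push_cast
      linarith
  rcases Nat.eq_zero_or_pos N with rfl | hN
  · rw [hw0, norm_zero]
    linarith
  · have hN' : (0 : ℝ) < N := by exact_mod_cast hN
    have h1 : ⟪G N, w N⟫ ≤ M * ‖w N‖ :=
      (real_inner_le_norm _ _).trans (mul_le_mul_of_nonneg_right (hG N) (norm_nonneg _))
    -- The two sums in `key` contribute M² and 4M² after division by N. The quadratic inequality
    -- gives ‖w_N‖ ≤ (1 + √6)M, which is below 4M.
    have h2 : ‖w N‖ ^ 2 ≤ 5 * M ^ 2 + 2 * (M * ‖w N‖) := by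
      refine le_of_mul_le_mul_left ?_ hN'
      have := mul_le_mul_of_nonneg_left h1 hN'.le
      linarith [key N]
    by_contra! h3
    nlinarith [norm_nonneg (w N)]

end Energy

/-! ### Integrals of step functions with step size k. -/

section StepFunctions

variable {k : ℝ}

theorem floor_div_eq (hk : 0 < k) {j : ℕ} {σ : ℝ} (h : σ ∈ Set.Ico (j * k) ((j + 1) * k)) :
    ⌊σ / k⌋₊ = j := by
  rw [Nat.floor_eq_iff (div_nonneg ((mul_nonneg j.cast_nonneg hk.le).trans h.1) hk.le)]
  exact ⟨(le_div_iff₀ hk).mpr h.1, (div_lt_iff₀ hk).mpr h.2⟩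

theorem mem_Ico_floor (hk : 0 < k) {σ : ℝ} (hσ : 0 ≤ σ) :
    σ ∈ Set.Ico (⌊σ / k⌋₊ * k) ((⌊σ / k⌋₊ + 1) * k) :=
  ⟨(le_div_iff₀ hk).mp (Nat.floor_le (div_nonneg hσ hk.le)),
    (div_lt_iff₀ hk).mp (Nat.lt_floor_add_one _)⟩

/-- The interval is open because the floor already jumps at b = (j + 1)k; endpoints do not affect
the integrals. -/
theorem step_eqOn {E : Type*} (hk : 0 < k) (f : ℕ → E) (j : ℕ) {b : ℝ}
    (hb : b ∈ Set.Icc (j * k) ((j + 1) * k)) :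
    (Set.uIoo (j * k) b).EqOn (fun _ => f j) fun σ => f ⌊σ / k⌋₊ := by
  intro σ hσ
  rw [Set.uIoo_of_le hb.1] at hσ
  simp only
  rw [floor_div_eq hk ⟨hσ.1.le, hσ.2.trans_le hb.2⟩]

theorem integral_step_aux {E : Type*} [NormedAddCommGroup E] [NormedSpace ℝ E] [CompleteSpace E]
    (hk : 0 < k) (f : ℕ → E) (n : ℕ) :
    IntervalIntegrable (fun σ => f ⌊σ / k⌋₊) volume 0 (n * k) ∧
      ∫ σ in (0 : ℝ)..(n * k), f ⌊σ / k⌋₊ = k • ∑ j ∈ Finset.range n, f j := by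
  induction n with
  | zero => simp
  | succ n ih =>
    have hb : ((n + 1 : ℕ) : ℝ) * k ∈ Set.Icc (n * k) ((n + 1) * k) := by
      push_cast
      exact ⟨by nlinarith, le_rfl⟩
    have hE := step_eqOn hk f n hb
    have hi : IntervalIntegrable (fun σ => f ⌊σ / k⌋₊) volume (n * k) ((n + 1 : ℕ) * k) :=
      intervalIntegrable_const.congr_uIoo hE
    refine ⟨ih.1.trans hi, ?_⟩
    rw [← intervalIntegral.integral_add_adjacent_intervals ih.1 hi, ih.2,
      ← intervalIntegral.integral_congr_uIoo hE, intervalIntegral.integral_const,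
      Finset.sum_range_succ, smul_add]
    congr 2
    push_cast
    ring

/-- The integral of a step function with step size `k`. -/
theorem integral_step {E : Type*} [NormedAddCommGroup E] [NormedSpace ℝ E] [CompleteSpace E]
    (hk : 0 < k) (f : ℕ → E) {t : ℝ} (ht : 0 ≤ t) :
    IntervalIntegrable (fun σ => f ⌊σ / k⌋₊) volume 0 t ∧
      ∫ σ in (0 : ℝ)..t, f ⌊σ / k⌋₊ =
        k • ∑ j ∈ Finset.range ⌊t / k⌋₊, f j + (t - ⌊t / k⌋₊ * k) • f ⌊t / k⌋₊ := by
  have hE := step_eqOn hk f _ (Set.Ico_subset_Icc_self (mem_Ico_floor hk ht))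
  have hi : IntervalIntegrable (fun σ => f ⌊σ / k⌋₊) volume (⌊t / k⌋₊ * k) t :=
    intervalIntegrable_const.congr_uIoo hE
  obtain ⟨h1, h2⟩ := integral_step_aux hk f ⌊t / k⌋₊
  refine ⟨h1.trans hi, ?_⟩
  rw [← intervalIntegral.integral_add_adjacent_intervals h1 hi, h2,
    ← intervalIntegral.integral_congr_uIoo hE, intervalIntegral.integral_const]

end StepFunctions

/-! ### Scalar bounds for the multipliers, with q = e^(-lk). -/

section Scalar

/-- `A⁻¹ (1 - e^(-jkA))` on an eigenvector with eigenvalue `l`. -/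
def primCoeff (l k : ℝ) (j : ℕ) : ℝ := l⁻¹ * (1 - Real.exp (-l * k) ^ j)

/-- The error of the right-endpoint rule for `∫ e^(-l σ)` over `(0, jk)`. -/
def quadCoeff (l k : ℝ) (j : ℕ) : ℝ :=
  primCoeff l k j - k * ∑ i ∈ Finset.range j, Real.exp (-l * k) ^ (i + 1)

/-- The error of the right-endpoint rule for `∫ e^(-l σ)` over `(0, t)`, where the last interval is
cut off at `t`. -/
def quadCoeffAt (l k t : ℝ) : ℝ :=
  l⁻¹ * (1 - Real.exp (-l * t)) - (k * ∑ i ∈ Finset.range ⌊t / k⌋₊, Real.exp (-l * k) ^ (i + 1)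
    + (t - ⌊t / k⌋₊ * k) * Real.exp (-l * k) ^ (⌊t / k⌋₊ + 1))

variable {l k : ℝ}

theorem exp_mul_nat (l k : ℝ) (j : ℕ) : Real.exp (-l * (j * k)) = Real.exp (-l * k) ^ j := by
  rw [← Real.exp_nat_mul]
  ring_nf

theorem exp_step_nonneg (l k : ℝ) : 0 ≤ Real.exp (-l * k) := (Real.exp_pos _).le

theorem exp_step_le_one (hl : 0 < l) (hk : 0 ≤ k) : Real.exp (-l * k) ≤ 1 :=
  Real.exp_le_one_iff.mpr (by nlinarith)

/-- The mean value bounds for an increment of `exp (-l t)`. -/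
theorem exp_increment_bounds (hl : 0 < l) {s t : ℝ} :
    (t - s) * Real.exp (-l * t) ≤ l⁻¹ * (Real.exp (-l * s) - Real.exp (-l * t)) ∧
      l⁻¹ * (Real.exp (-l * s) - Real.exp (-l * t)) ≤ (t - s) * Real.exp (-l * s) := by
  constructor
  · rw [inv_mul_eq_div, le_div_iff₀ hl]
    have h := Real.add_one_le_exp (l * (t - s))
    have h1 : Real.exp (-l * s) = Real.exp (l * (t - s)) * Real.exp (-l * t) := by
      rw [← Real.exp_add]; ring_nf
    rw [h1]
    nlinarith [Real.exp_pos (-l * t)]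
  · rw [inv_mul_eq_div, div_le_iff₀ hl]
    have h := Real.add_one_le_exp (-(l * (t - s)))
    have h1 : Real.exp (-l * t) = Real.exp (-(l * (t - s))) * Real.exp (-l * s) := by
      rw [← Real.exp_add]; ring_nf
    rw [h1]
    nlinarith [Real.exp_pos (-l * s)]

theorem primCoeff_succ_sub (l k : ℝ) (j : ℕ) : primCoeff l k (j + 1) - primCoeff l k j =
    l⁻¹ * (Real.exp (-l * k) ^ j - Real.exp (-l * k) ^ (j + 1)) := by
  rw [primCoeff, primCoeff]
  ring

theorem quadCoeff_succ_sub (l k : ℝ) (j : ℕ) : quadCoeff l k (j + 1) - quadCoeff l k j =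
    l⁻¹ * (Real.exp (-l * k) ^ j - Real.exp (-l * k) ^ (j + 1))
      - k * Real.exp (-l * k) ^ (j + 1) := by
  rw [quadCoeff, quadCoeff, Finset.sum_range_succ, ← primCoeff_succ_sub]
  ring

theorem pow_succ_le_pow_step (hl : 0 < l) (hk : 0 ≤ k) (j : ℕ) :
    Real.exp (-l * k) ^ (j + 1) ≤ Real.exp (-l * k) ^ j :=
  pow_le_pow_of_le_one (exp_step_nonneg l k) (exp_step_le_one hl hk) j.le_succ

/-- On one step the integral of the decreasing exponential lies between k times its right and k
times its left endpoint value. -/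
theorem quadCoeff_increment_bounds (hl : 0 < l) (k : ℝ) (j : ℕ) :
    0 ≤ quadCoeff l k (j + 1) - quadCoeff l k j ∧
      quadCoeff l k (j + 1) - quadCoeff l k j ≤
        k * (Real.exp (-l * k) ^ j - Real.exp (-l * k) ^ (j + 1)) := by
  have h := exp_increment_bounds hl (s := j * k) (t := (j + 1 : ℕ) * k)
  rw [exp_mul_nat, exp_mul_nat] at h
  push_cast at h
  rw [quadCoeff_succ_sub]
  constructor <;> linarith [h.1, h.2]

theorem primCoeff_bounds (hl : 0 < l) (hk : 0 ≤ k) (j : ℕ) :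
    0 ≤ primCoeff l k j ∧ primCoeff l k j ≤ l⁻¹ := by
  have h1 := pow_le_one₀ (exp_step_nonneg l k) (exp_step_le_one hl hk) (n := j)
  have h2 := pow_nonneg (exp_step_nonneg l k) j
  have h3 := inv_pos.mpr hl
  rw [primCoeff]
  constructor <;> nlinarith

theorem quadCoeff_bounds (hl : 0 < l) (k : ℝ) (j : ℕ) :
    0 ≤ quadCoeff l k j ∧ quadCoeff l k j ≤ k * (1 - Real.exp (-l * k) ^ j) := by
  induction j with
  | zero => simp [quadCoeff, primCoeff]
  | succ j ih =>
    have h := quadCoeff_increment_bounds hl k j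
    constructor <;> linarith [ih.1, ih.2, h.1, h.2]

theorem quadCoeff_le_primCoeff (l : ℝ) (hk : 0 ≤ k) (j : ℕ) :
    quadCoeff l k j ≤ primCoeff l k j :=
  sub_le_self _ (mul_nonneg hk (Finset.sum_nonneg fun _ _ => pow_nonneg (exp_step_nonneg l k) _))

/-- `min k l⁻¹ ≤ k^(1-θ) l^(-θ)`, in squared form. -/
theorem sq_le_of_le_min (hl : 0 < l) (hk : 0 < k) {ρ m : ℝ} (hρ : ρ ∈ Set.Icc (0 : ℝ) 1)
    (hm : 0 ≤ m) (h1 : m ≤ k) (h2 : m ≤ l⁻¹) : m ^ 2 ≤ (k ^ ((2 - ρ) / 2)) ^ 2 * l ^ (-ρ) := by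
  rw [← Real.rpow_mul_natCast hk.le, Real.rpow_neg hl.le, ← Real.inv_rpow hl.le]
  have e1 : (2 - ρ) / 2 * (2 : ℕ) = 2 - ρ := by push_cast; ring
  rw [e1]
  calc m ^ 2 = m ^ ((2 - ρ) + ρ) := by rw [sub_add_cancel, Real.rpow_two]
    _ = m ^ (2 - ρ) * m ^ ρ := Real.rpow_add_of_nonneg hm (by linarith [hρ.2]) hρ.1
    _ ≤ _ := mul_le_mul (Real.rpow_le_rpow hm h1 (by linarith [hρ.2]))
      (Real.rpow_le_rpow hm h2 hρ.1) (Real.rpow_nonneg hm _) (Real.rpow_nonneg hk.le _)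

theorem quadCoeff_sq_le (hl : 0 < l) (hk : 0 < k) {ρ : ℝ} (hρ : ρ ∈ Set.Icc (0 : ℝ) 1) (j : ℕ) :
    quadCoeff l k j ^ 2 ≤ (k ^ ((2 - ρ) / 2)) ^ 2 * l ^ (-ρ) := by
  have h := quadCoeff_bounds hl k j
  have h2 := pow_nonneg (exp_step_nonneg l k) j
  exact sq_le_of_le_min hl hk hρ h.1 (by nlinarith)
    ((quadCoeff_le_primCoeff l hk.le j).trans (primCoeff_bounds hl hk.le j).2)

theorem quadCoeffAt_sq_le (hl : 0 < l) (hk : 0 < k) {ρ t : ℝ} (hρ : ρ ∈ Set.Icc (0 : ℝ) 1)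
    (ht : 0 ≤ t) : quadCoeffAt l k t ^ 2 ≤ (k ^ ((2 - ρ) / 2)) ^ 2 * l ^ (-ρ) := by
  have hn := mem_Ico_floor hk ht
  have h1 := quadCoeff_bounds hl k ⌊t / k⌋₊
  have h2 := exp_increment_bounds hl (s := ⌊t / k⌋₊ * k) (t := t)
  have h3 : Real.exp (-l * k) ^ (⌊t / k⌋₊ + 1) ≤ Real.exp (-l * t) := by
    rw [← exp_mul_nat]
    push_cast
    exact Real.exp_le_exp.mpr (by nlinarith [hn.2])
  have h4 := pow_nonneg (exp_step_nonneg l k) (⌊t / k⌋₊ + 1)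
  have h5 := pow_nonneg (exp_step_nonneg l k) ⌊t / k⌋₊
  rw [exp_mul_nat] at h2
  have e1 : quadCoeffAt l k t = quadCoeff l k ⌊t / k⌋₊
      + l⁻¹ * (Real.exp (-l * k) ^ ⌊t / k⌋₊ - Real.exp (-l * t))
      - (t - ⌊t / k⌋₊ * k) * Real.exp (-l * k) ^ (⌊t / k⌋₊ + 1) := by
    rw [quadCoeffAt, quadCoeff, primCoeff]
    ring
  have h6 : 0 ≤ t - ⌊t / k⌋₊ * k := by linarith [hn.1]
  have h7 : t - ⌊t / k⌋₊ * k ≤ k := by linarith [hn.2]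
  have h8 := mul_le_mul_of_nonneg_left h3 h6
  have h9 := mul_nonneg h6 h4
  refine sq_le_of_le_min hl hk hρ ?_ ?_ ?_
  · linarith [h1.1, h2.1]
  -- With m full steps the total is at most k(1 - q^m) + (t - mk)q^m, hence at most k.
  · have := mul_le_mul_of_nonneg_right h7 h5
    linarith [h1.2, h2.2]
  · have h10 : 0 ≤ k * ∑ i ∈ Finset.range ⌊t / k⌋₊, Real.exp (-l * k) ^ (i + 1) :=
      mul_nonneg hk.le (Finset.sum_nonneg fun _ _ => pow_nonneg (exp_step_nonneg l k) _)
    have h11 := mul_pos (inv_pos.mpr hl) (Real.exp_pos (-l * t))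
    rw [quadCoeffAt]
    linarith

/-- The decrements q^j - q^(j+1) decrease in j, so j + 1 copies of the last are at most the sum of
the first j + 1, which telescopes to 1 - q^(j+1). This discrete smoothing property controls the
time-weighted increments of the residual. -/
theorem succ_mul_pow_le (hl : 0 < l) (hk : 0 ≤ k) (j : ℕ) :
    (j + 1) * (Real.exp (-l * k) ^ j - Real.exp (-l * k) ^ (j + 1)) ≤ 1 := by
  have h : (j + 1) * (Real.exp (-l * k) ^ j - Real.exp (-l * k) ^ (j + 1))
      ≤ 1 - Real.exp (-l * k) ^ (j + 1) := by
    induction j with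
    | zero => simp
    | succ j ih =>
      have h1 := pow_succ_le_pow_step hl hk j
      have h2 := exp_step_le_one hl hk
      have h3 := mul_le_mul_of_nonneg_right h2 (sub_nonneg.mpr h1)
      have h4 : Real.exp (-l * k) ^ (j + 1) - Real.exp (-l * k) ^ (j + 1 + 1)
          ≤ Real.exp (-l * k) ^ j - Real.exp (-l * k) ^ (j + 1) := by
        simp only [pow_succ] at h3 ⊢
        linarith
      have h5 := mul_le_mul_of_nonneg_left h4 (by positivity : (0 : ℝ) ≤ j + 1)
      push_cast
      linarith
  linarith [pow_nonneg (exp_step_nonneg l k) (j + 1)]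

theorem succ_mul_primCoeff_sub_bounds (hl : 0 < l) (hk : 0 ≤ k) (j : ℕ) :
    0 ≤ (j + 1) * (primCoeff l k (j + 1) - primCoeff l k j) ∧
      (j + 1) * (primCoeff l k (j + 1) - primCoeff l k j) ≤ l⁻¹ := by
  have h1 := pow_succ_le_pow_step hl hk j
  have h2 := mul_le_mul_of_nonneg_left (succ_mul_pow_le hl hk j) (inv_pos.mpr hl).le
  rw [primCoeff_succ_sub]
  refine ⟨?_, by linarith⟩
  have := inv_pos.mpr hl
  have := sub_nonneg.mpr h1
  positivity

theorem succ_mul_quadCoeff_sub_sq_le (hl : 0 < l) (hk : 0 < k) {ρ : ℝ}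
    (hρ : ρ ∈ Set.Icc (0 : ℝ) 1) (j : ℕ) :
    ((j + 1) * (quadCoeff l k (j + 1) - quadCoeff l k j)) ^ 2
      ≤ (k ^ ((2 - ρ) / 2)) ^ 2 * l ^ (-ρ) := by
  have h := quadCoeff_increment_bounds hl k j
  have hj : (0 : ℝ) ≤ j + 1 := by positivity
  refine sq_le_of_le_min hl hk hρ (mul_nonneg hj h.1) ?_ ?_
  · have h1 := mul_le_mul_of_nonneg_left h.2 hj
    have h2 := mul_le_mul_of_nonneg_left (succ_mul_pow_le hl hk.le j) hk.le
    linarith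
  · have h1 := (succ_mul_primCoeff_sub_bounds hl hk.le j).2
    refine le_trans (mul_le_mul_of_nonneg_left ?_ hj) h1
    rw [quadCoeff_succ_sub, primCoeff_succ_sub]
    exact sub_le_self _ (mul_nonneg hk.le (pow_nonneg (exp_step_nonneg l k) _))

/-- Each decrement is q^j(1 - q) ≤ 1 - q; taking out one such factor leaves a telescoping sum. -/
theorem sum_increment_sq_le (hl : 0 < l) (hk : 0 ≤ k) (N : ℕ) :
    ∑ j ∈ Finset.range N, (Real.exp (-l * k) ^ j - Real.exp (-l * k) ^ (j + 1)) ^ 2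
      ≤ 1 - Real.exp (-l * k) := by
  have hq := exp_step_le_one hl hk
  calc _ ≤ ∑ j ∈ Finset.range N, (1 - Real.exp (-l * k)) *
        (Real.exp (-l * k) ^ j - Real.exp (-l * k) ^ (j + 1)) := by
        refine Finset.sum_le_sum fun j _ => ?_
        rw [sq]
        refine mul_le_mul_of_nonneg_right ?_ (sub_nonneg.mpr (pow_succ_le_pow_step hl hk j))
        have h := pow_le_one₀ (exp_step_nonneg l k) hq (n := j)
        rw [pow_succ]
        nlinarith
    _ = (1 - Real.exp (-l * k)) * (1 - Real.exp (-l * k) ^ N) := by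
        rw [← Finset.mul_sum, Finset.sum_range_sub', pow_zero]
    _ ≤ _ := by
        have h := pow_nonneg (exp_step_nonneg l k) N
        nlinarith

/-- Interpolates between the bounds 1 and kl. -/
theorem one_sub_exp_le (hl : 0 < l) (hk : 0 < k) {ρ : ℝ} (hρ : ρ ∈ Set.Icc (0 : ℝ) 1) :
    1 - Real.exp (-l * k) ≤ k ^ ρ * l ^ ρ := by
  have h1 := Real.add_one_le_exp (-l * k)
  have h0 := exp_step_le_one hl hk.le
  have h2 := exp_step_nonneg l k
  rw [← Real.mul_rpow hk.le hl.le]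
  calc 1 - Real.exp (-l * k) = (1 - Real.exp (-l * k)) ^ ((1 - ρ) + ρ) := by simp
    _ = (1 - Real.exp (-l * k)) ^ (1 - ρ) * (1 - Real.exp (-l * k)) ^ ρ :=
      Real.rpow_add_of_nonneg (by linarith) (by linarith [hρ.2]) hρ.1
    _ ≤ 1 * (k * l) ^ ρ := mul_le_mul
      (Real.rpow_le_one (by linarith) (by linarith) (by linarith [hρ.2]))
      (Real.rpow_le_rpow (by linarith) (by linarith) hρ.1) (Real.rpow_nonneg (by linarith) _)
      zero_le_one
    _ = _ := one_mul _

end Scalar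

/-! ### Smoothing, measurability and integration of the semigroup on Ḣ^(-1). -/

section Semigroup

variable {H : Type*} [NormedAddCommGroup H] [InnerProductSpace ℝ H] {ι : Type*}
  {e : HilbertBasis ι ℝ H} {lam : ι → ℝ} {x : ι → ℝ} {t : ℝ}

theorem countable_of_hilbertBasis [TopologicalSpace.SeparableSpace H] (e : HilbertBasis ι ℝ H) :
    Countable ι := by
  refine Pairwise.countable_of_isOpen_disjoint (s := fun n => Metric.ball (e n) (1 / 2))
    (fun i j hij => Metric.ball_disjoint_ball ?_) (fun _ => Metric.isOpen_ball)
    (fun n => Metric.nonempty_ball.mpr (by norm_num))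
  have h := norm_sub_sq_real (e i) (e j)
  rw [e.orthonormal.1 i, e.orthonormal.1 j, e.orthonormal.2 hij] at h
  rw [dist_eq_norm]
  nlinarith [norm_nonneg (e i - e j)]

/-- This is lt ≤ e^(2lt). It yields ‖E(t)x‖ ≤ t^(-1/2)‖x‖_{-1}, whose singularity at 0 is
integrable. -/
theorem exp_sq_le (ht : 0 < t) {l : ℝ} (hl : 0 < l) :
    l ^ (0 : ℝ) * Real.exp (-l * t) ^ 2 ≤ (t ^ (-(1 / 2) : ℝ)) ^ 2 * l ^ (-1 : ℝ) := by
  have h1 : (t ^ (-(1 / 2) : ℝ)) ^ 2 = t⁻¹ := by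
    rw [← Real.rpow_mul_natCast ht.le, ← Real.rpow_neg_one]
    norm_num
  rw [h1, Real.rpow_zero, one_mul, Real.rpow_neg_one, ← mul_inv, le_inv_comm₀ (by positivity)
    (by positivity), ← inv_pow, ← Real.exp_neg, ← Real.exp_nat_mul]
  have h2 := Real.add_one_le_exp ((2 : ℕ) * -(-l * t))
  push_cast at h2 ⊢
  nlinarith [mul_pos hl ht]

theorem summable_semigroup (hlam : ∀ n, 0 < lam n) (hx : x ∈ Hdot lam (-1)) (ht : 0 < t) :
    Summable fun n => (Real.exp (-lam n * t) * x n) ^ 2 :=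
  mem_Hdot_zero.mp (mul_mem_Hdot hlam (fun n => exp_sq_le ht (hlam n)) hx)

theorem norm_semigroup_le (hlam : ∀ n, 0 < lam n) (hx : x ∈ Hdot lam (-1)) (ht : 0 < t) :
    ‖semigroup e lam t x‖ ≤ t ^ (-(1 / 2) : ℝ) * hdotNorm lam (-1) x := by
  rw [semigroup, norm_toH (summable_semigroup hlam hx ht)]
  exact hdotNorm_mul_le hlam (Real.rpow_nonneg ht.le _) (fun n => exp_sq_le ht (hlam n)) hx

/-- The semigroup is the pointwise limit of continuous finite partial sums on σ > 0. Countability of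
ι makes the filter `atTop` on `Finset ι` countably generated, as the limit theorem requires. -/
theorem aestronglyMeasurable_semigroup [Countable ι] (hlam : ∀ n, 0 < lam n)
    (hx : x ∈ Hdot lam (-1)) (t : ℝ) :
    AEStronglyMeasurable (fun σ => semigroup e lam σ x) (volume.restrict (Set.Ioc 0 t)) := by
  refine aestronglyMeasurable_of_tendsto_ae (Filter.atTop (α := Finset ι))
    (f := fun s σ => ∑ n ∈ s, (Real.exp (-lam n * σ) * x n) • e n) (fun s => ?_) ?_
  · exact (Continuous.aestronglyMeasurable (by fun_prop))
  · refine (ae_restrict_iff' measurableSet_Ioc).mpr (Filter.Eventually.of_forall fun σ hσ => ?_)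
    exact hasSum_toH (summable_semigroup hlam hx hσ.1)

theorem intervalIntegrable_semigroup [Countable ι] (hlam : ∀ n, 0 < lam n)
    (hx : x ∈ Hdot lam (-1)) (ht : 0 ≤ t) :
    IntervalIntegrable (fun σ => semigroup e lam σ x) volume 0 t := by
  have h : IntervalIntegrable (fun σ : ℝ => σ ^ (-(1 / 2) : ℝ) * hdotNorm lam (-1) x)
      volume 0 t := (intervalIntegral.intervalIntegrable_rpow' (by norm_num)).mul_const _
  refine h.mono_fun' ?_ ?_
  · rw [Set.uIoc_of_le ht]
    exact aestronglyMeasurable_semigroup hlam hx t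
  · rw [Set.uIoc_of_le ht]
    exact (ae_restrict_iff' measurableSet_Ioc).mpr
      (Filter.Eventually.of_forall fun σ hσ => norm_semigroup_le hlam hx hσ.1)

theorem coeff_injective {f g : H} (h : coeff e f = coeff e g) : f = g := by
  rw [← toH_coeff (e := e) f, h, toH_coeff]

theorem integral_exp_neg_mul {l : ℝ} (hl : l ≠ 0) (t : ℝ) :
    ∫ σ in (0 : ℝ)..t, Real.exp (-l * σ) = l⁻¹ * (1 - Real.exp (-l * t)) := by
  have h := intervalIntegral.integral_comp_mul_left (a := 0) (b := t) Real.exp (neg_ne_zero.mpr hl)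
  rw [h, integral_exp, mul_zero, Real.exp_zero, smul_eq_mul, inv_neg]
  ring

theorem prim_bounds {l : ℝ} (hl : 0 < l) (ht : 0 ≤ t) :
    0 ≤ l⁻¹ * (1 - Real.exp (-l * t)) ∧ l⁻¹ * (1 - Real.exp (-l * t)) ≤ l⁻¹ := by
  have h1 := exp_step_le_one hl ht
  have h2 := exp_step_nonneg l t
  have h3 := inv_pos.mpr hl
  constructor <;> nlinarith

theorem rpow_mul_sq_le {l r m : ℝ} (hl : 0 < l) (hm : 0 ≤ m) (hm' : m ≤ l⁻¹) :
    l ^ r * m ^ 2 ≤ 1 ^ 2 * l ^ (r - 2) := by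
  rw [Real.rpow_sub hl, Real.rpow_two, one_pow, one_mul, div_eq_mul_inv, ← inv_pow]
  exact mul_le_mul_of_nonneg_left (pow_le_pow_left₀ hm hm' 2) (Real.rpow_nonneg hl.le _)

theorem mul_mem_Hdot_one (hlam : ∀ n, 0 < lam n) (hx : x ∈ Hdot lam (-1)) {m : ι → ℝ}
    (hm : ∀ n, 0 ≤ m n ∧ m n ≤ (lam n)⁻¹) : (fun n => m n * x n) ∈ Hdot lam 1 := by
  refine mul_mem_Hdot hlam (K := 1 ^ 2) (fun n => ?_) hx
  have := rpow_mul_sq_le (r := 1) (hlam n) (hm n).1 (hm n).2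
  norm_num at this ⊢
  exact this

theorem integral_semigroup [CompleteSpace H] [Countable ι] {c : ℝ} (hc : 0 < c)
    (hlam : ∀ n, c ≤ lam n)
    (hx : x ∈ Hdot lam (-1)) (ht : 0 ≤ t) : ∫ σ in (0 : ℝ)..t, semigroup e lam σ x =
      toH e fun n => (lam n)⁻¹ * (1 - Real.exp (-lam n * t)) * x n := by
  have hpos : ∀ n, 0 < lam n := fun n => hc.trans_le (hlam n)
  have hi := intervalIntegrable_semigroup (e := e) hpos hx ht
  refine coeff_injective (e := e) ?_
  rw [coeff_toH (mem_Hdot_zero.mp (Hdot_mono hc hlam zero_le_one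
    (mul_mem_Hdot_one hpos hx fun n => prim_bounds (hpos n) ht)))]
  funext n
  have h := (innerSL ℝ (e n)).intervalIntegral_comp_comm hi
  simp only [innerSL_apply_apply] at h
  rw [coeff, ← h, ← integral_exp_neg_mul (hpos n).ne', ← intervalIntegral.integral_mul_const]
  refine intervalIntegral.integral_congr_Ioo_of_le ht fun σ hσ => ?_
  exact congrFun (coeff_toH (e := e) (summable_semigroup hpos hx hσ.1)) n

end Semigroup

/-! ### Interpolated approximation property and consistency errors. -/

section Consistency

variable {H : Type*} [NormedAddCommGroup H] [InnerProductSpace ℝ H] {ι : Type*}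
  {e : HilbertBasis ι ℝ H} {lam : ι → ℝ} {x : ι → ℝ} {c : ℝ}

/-- The approximation property, interpolated between `Ḣ^1` and `Ḣ^2`. -/
theorem approximation_interpolated {S : Submodule ℝ H} [FiniteDimensional ℝ S] (hc : 0 < c)
    (hlam : ∀ n, c ≤ lam n)
    (hS : ∀ y ∈ S, coeff e y ∈ Hdot lam 1) {C h : ℝ} (hC : 0 ≤ C) (hh : 0 < h)
    (h1 : ∀ x ∈ Hdot lam 1, ‖(ritz e lam S x : H) - toH e x‖ ≤ C * h * hdotNorm lam 1 x)
    (h2 : ∀ x ∈ Hdot lam 2, ‖(ritz e lam S x : H) - toH e x‖ ≤ C * h ^ 2 * hdotNorm lam 2 x)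
    {s : ℝ} (hs : s ∈ Set.Icc (1 : ℝ) 2) (hx : x ∈ Hdot lam s) :
    ‖(ritz e lam S x : H) - toH e x‖ ≤ 2 * C * h ^ s * hdotNorm lam s x := by
  classical
  have hpos : ∀ n, 0 < lam n := fun n => hc.trans_le (hlam n)
  -- Spectral cut at λh² = 1: the low part is placed in Ḣ^2 at the cost h^(s-2), the high part in
  -- Ḣ^1 at the cost h^(s-1). Each contributes C h^s, hence the factor 2.
  set a : ι → ℝ := fun n => if lam n * h ^ 2 ≤ 1 then 1 else 0 with ha
  set b : ι → ℝ := fun n => if lam n * h ^ 2 ≤ 1 then 0 else 1 with hb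
  have hmul : ∀ (n : ι) (r : ℝ), (lam n * h ^ 2) ^ r = lam n ^ r * (h ^ r) ^ 2 := fun n r => by
    rw [Real.mul_rpow (hpos n).le (by positivity), ← Real.rpow_natCast_mul hh.le,
      ← Real.rpow_mul_natCast hh.le, mul_comm r]
  have hlow : ∀ n, lam n ^ (2 : ℝ) * a n ^ 2 ≤ (h ^ (s - 2)) ^ 2 * lam n ^ s := by
    intro n
    simp only [ha]
    split_ifs with hn
    · have h3 := Real.one_le_rpow_of_pos_of_le_one_of_nonpos
        (mul_pos (hpos n) (pow_pos hh 2)) hn (sub_nonpos.mpr hs.2)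
      rw [hmul] at h3
      have h4 := mul_le_mul_of_nonneg_left h3 (Real.rpow_nonneg (hpos n).le 2)
      have h5 : lam n ^ (2 : ℝ) * lam n ^ (s - 2) = lam n ^ s := by
        rw [← Real.rpow_add (hpos n), add_sub_cancel]
      rw [← h5]
      linarith
    · have := Real.rpow_nonneg (hpos n).le s
      simpa using mul_nonneg (sq_nonneg _) this
  have hhigh : ∀ n, lam n ^ (1 : ℝ) * b n ^ 2 ≤ (h ^ (s - 1)) ^ 2 * lam n ^ s := by
    intro n
    simp only [hb]
    split_ifs with hn
    · have := Real.rpow_nonneg (hpos n).le s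
      simpa using mul_nonneg (sq_nonneg _) this
    · have h3 := Real.one_le_rpow (not_le.mp hn).le (sub_nonneg.mpr hs.1)
      rw [hmul] at h3
      have h4 := mul_le_mul_of_nonneg_left h3 (Real.rpow_nonneg (hpos n).le 1)
      have h5 : lam n ^ (1 : ℝ) * lam n ^ (s - 1) = lam n ^ s := by
        rw [← Real.rpow_add (hpos n), add_sub_cancel]
      rw [← h5]
      linarith
  have hlx := mul_mem_Hdot hpos hlow hx
  have hhx := mul_mem_Hdot hpos hhigh hx
  have hlx1 := Hdot_mono hc hlam (by norm_num : (1 : ℝ) ≤ 2) hlx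
  have hsplit : x = fun n => a n * x n + b n * x n := by
    funext n
    simp only [ha, hb]
    split_ifs <;> ring
  have e1 : (ritz e lam S x : H) = ritz e lam S (fun n => a n * x n) +
      ritz e lam S (fun n => b n * x n) := by
    conv_lhs => rw [hsplit]
    rw [ritz_add hpos hS hlx1 hhx, Submodule.coe_add]
  have e2 : toH e x = toH e (fun n => a n * x n) + toH e (fun n => b n * x n) := by
    conv_lhs => rw [hsplit]
    exact toH_add (mem_Hdot_zero.mp (Hdot_mono hc hlam zero_le_one hlx1))
      (mem_Hdot_zero.mp (Hdot_mono hc hlam zero_le_one hhx))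
  have n1 := (h2 _ hlx).trans (mul_le_mul_of_nonneg_left
    (hdotNorm_mul_le hpos (Real.rpow_nonneg hh.le _) hlow hx) (by positivity))
  have n2 := (h1 _ hhx).trans (mul_le_mul_of_nonneg_left
    (hdotNorm_mul_le hpos (Real.rpow_nonneg hh.le _) hhigh hx) (by positivity))
  have p1 : h ^ 2 * h ^ (s - 2) = h ^ s := by
    rw [← Real.rpow_two, ← Real.rpow_add hh, add_sub_cancel]
  have p2 : h * h ^ (s - 1) = h ^ s := by
    nth_rewrite 1 [← Real.rpow_one h]
    rw [← Real.rpow_add hh, add_sub_cancel]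
  rw [e1, e2, add_sub_add_comm]
  refine (norm_add_le _ _).trans ((add_le_add n1 n2).trans (le_of_eq ?_))
  linear_combination C * hdotNorm lam s x * (p1 + p2)

/-- The consistency error `(R_h - I) a x + d x`, for multipliers `a` and `d`. -/
def consistErr (e : HilbertBasis ι ℝ H) (lam : ι → ℝ) (S : Submodule ℝ H) (a d x : ι → ℝ) : H :=
  ritz e lam S (fun n => a n * x n) - toH e (fun n => a n * x n) + toH e (fun n => d n * x n)

theorem consistErr_sub {S : Submodule ℝ H} [FiniteDimensional ℝ S] (hc : 0 < c)
    (hlam : ∀ n, c ≤ lam n)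
    (hS : ∀ y ∈ S, coeff e y ∈ Hdot lam 1) {a a' d d' : ι → ℝ}
    (ha : (fun n => a n * x n) ∈ Hdot lam 1) (ha' : (fun n => a' n * x n) ∈ Hdot lam 1)
    (hd : Summable fun n => (d n * x n) ^ 2) (hd' : Summable fun n => (d' n * x n) ^ 2) :
    consistErr e lam S a d x - consistErr e lam S a' d' x =
      consistErr e lam S (fun n => a n - a' n) (fun n => d n - d' n) x := by
  simp only [consistErr, sub_mul]
  rw [ritz_sub (fun n => hc.trans_le (hlam n)) hS ha ha', toH_sub hd hd', toH_sub
    (mem_Hdot_zero.mp (Hdot_mono hc hlam zero_le_one ha))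
    (mem_Hdot_zero.mp (Hdot_mono hc hlam zero_le_one ha')), Submodule.coe_sub]
  abel

theorem consistErr_smul {S : Submodule ℝ H} [FiniteDimensional ℝ S] (hc : 0 < c)
    (hlam : ∀ n, c ≤ lam n)
    (hS : ∀ y ∈ S, coeff e y ∈ Hdot lam 1) {a d : ι → ℝ} (b : ℝ)
    (ha : (fun n => a n * x n) ∈ Hdot lam 1) (hd : Summable fun n => (d n * x n) ^ 2) :
    b • consistErr e lam S a d x = consistErr e lam S (fun n => b * a n) (fun n => b * d n) x := by
  simp only [consistErr, mul_assoc]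
  rw [ritz_smul (fun n => hc.trans_le (hlam n)) hS b ha, toH_smul b hd, toH_smul b
    (mem_Hdot_zero.mp (Hdot_mono hc hlam zero_le_one ha)), Submodule.coe_smul, smul_add, smul_sub]

theorem norm_consistErr_le {S : Submodule ℝ H} {δ s : ℝ} {a d : ι → ℝ}
    (hR : ∀ y ∈ Hdot lam s, ‖(ritz e lam S y : H) - toH e y‖ ≤ δ * hdotNorm lam s y)
    (ha : (fun n => a n * x n) ∈ Hdot lam s) (hd : Summable fun n => (d n * x n) ^ 2) :
    ‖consistErr e lam S a d x‖ ≤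
      δ * hdotNorm lam s (fun n => a n * x n) + hdotNorm lam 0 fun n => d n * x n :=
  (norm_add_le _ _).trans (add_le_add (hR _ ha) (norm_toH hd).le)

end Consistency

/-! ### Error equation and the bound for the integrated error. -/

section ErrorEstimates

variable {H : Type*} [NormedAddCommGroup H] [InnerProductSpace ℝ H] {ι : Type*}
  {e : HilbertBasis ι ℝ H} {lam : ι → ℝ} {S : Submodule ℝ H} [FiniteDimensional ℝ S]
  {x : ι → ℝ} {c k ρ δ : ℝ}

/-- The exact solution `E(jk) x` at the grid points. -/
def gridSol (e : HilbertBasis ι ℝ H) (lam : ι → ℝ) (k : ℝ) (x : ι → ℝ) (j : ℕ) : H :=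
  toH e fun n => Real.exp (-lam n * k) ^ j * x n

/-- The consistency error of the scheme for the integrated equation, at time `jk`. -/
def gridErr (e : HilbertBasis ι ℝ H) (lam : ι → ℝ) (S : Submodule ℝ H) (k : ℝ) (x : ι → ℝ)
    (j : ℕ) : H :=
  consistErr e lam S (fun n => primCoeff (lam n) k j) (fun n => quadCoeff (lam n) k j) x

/-- The exponent j + 1 keeps the time positive; at time 0 a rough x need not belong to H. -/
theorem summable_gridSol_succ (hlam : ∀ n, 0 < lam n) (hx : x ∈ Hdot lam (-1)) (hk : 0 < k)
    (j : ℕ) : Summable fun n => (Real.exp (-lam n * k) ^ (j + 1) * x n) ^ 2 := by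
  have h := summable_semigroup hlam hx (t := (j + 1 : ℕ) * k) (by positivity)
  simpa only [exp_mul_nat] using h

theorem primCoeff_mul_mem (hlam : ∀ n, 0 < lam n) (hx : x ∈ Hdot lam (-1)) (hk : 0 < k) (j : ℕ) :
    (fun n => primCoeff (lam n) k j * x n) ∈ Hdot lam 1 :=
  mul_mem_Hdot_one hlam hx fun n => primCoeff_bounds (hlam n) hk.le j

theorem quadCoeff_mul_summable (hc : 0 < c) (hlam : ∀ n, c ≤ lam n) (hx : x ∈ Hdot lam (-1))
    (hk : 0 < k) (j : ℕ) : Summable fun n => (quadCoeff (lam n) k j * x n) ^ 2 := by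
  have hpos : ∀ n, 0 < lam n := fun n => hc.trans_le (hlam n)
  refine mem_Hdot_zero.mp (Hdot_mono hc hlam zero_le_one (mul_mem_Hdot_one hpos hx fun n => ?_))
  exact ⟨(quadCoeff_bounds (hpos n) k j).1,
    (quadCoeff_le_primCoeff _ hk.le j).trans (primCoeff_bounds (hpos n) hk.le j).2⟩

theorem toH_quadCoeff (hc : 0 < c) (hlam : ∀ n, c ≤ lam n) (hx : x ∈ Hdot lam (-1))
    (hk : 0 < k) (j : ℕ) : toH e (fun n => quadCoeff (lam n) k j * x n) =
      toH e (fun n => primCoeff (lam n) k j * x n) -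
        k • ∑ i ∈ Finset.range j, gridSol e lam k x (i + 1) := by
  have hpos : ∀ n, 0 < lam n := fun n => hc.trans_le (hlam n)
  have hs := fun i => hasSum_toH (e := e) (summable_gridSol_succ hpos hx hk i)
  have h1 := hasSum_toH (e := e)
    (mem_Hdot_zero.mp (Hdot_mono hc hlam zero_le_one (primCoeff_mul_mem hpos hx hk j)))
  have h2 := h1.sub ((hasSum_sum (s := Finset.range j) fun i _ => hs i).const_smul k)
  refine HasSum.tsum_eq (h2.congr_fun fun n => ?_)
  beta_reduce
  rw [← Finset.sum_smul, smul_smul, ← sub_smul, quadCoeff, ← Finset.sum_mul]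
  ring_nf

/-- The error equation for the integrated problem. -/
theorem solutionOp_error (hc : 0 < c) (hlam : ∀ n, c ≤ lam n)
    (hS : ∀ y ∈ S, coeff e y ∈ Hdot lam 1) (hk : 0 < k) (hx : x ∈ Hdot lam (-1)) (j : ℕ)
    (hj : Summable fun n => (Real.exp (-lam n * k) ^ j * x n) ^ 2) :
    solutionOp S hc hlam hS (eulerSeq e lam S k x j - gridSol e lam k x j) =
      gridErr e lam S k x j - k • ∑ i ∈ Finset.range j,
        ((eulerSeq e lam S k x (i + 1) : H) - gridSol e lam k x (i + 1)) := by
  have hpos : ∀ n, 0 < lam n := fun n => hc.trans_le (hlam n)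
  have h1 := solutionOp_eulerSeq hc hlam hS hk x j
  have hx1 : fracPow lam (-1) x ∈ Hdot lam 1 := fracPow_mem_Hdot hpos (by norm_num; exact hx)
  -- Linearity of R_h, since A⁻¹(I - E(jk))x = A⁻¹x - A⁻¹u_j and T u_j = R_h A⁻¹u_j.
  have h2 : (ritz e lam S (fun n => primCoeff (lam n) k j * x n) : H) =
      ritz e lam S (fracPow lam (-1) x) - solutionOp S hc hlam hS (gridSol e lam k x j) := by
    have h3 := ritz_sub hpos hS hx1
      (fracPow_neg_one_coeff_mem (e := e) hc hlam (gridSol e lam k x j))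
    have h4 := congrArg (Subtype.val : S → H) h3
    rw [Submodule.coe_sub] at h4
    refine Eq.trans (congrArg (fun z => (ritz e lam S z : H)) (funext fun n => ?_)) h4
    rw [gridSol, coeff_toH hj]
    simp only [fracPow, primCoeff, Real.rpow_neg_one]
    ring
  rw [gridErr, consistErr, h2, toH_quadCoeff hc hlam hx hk, map_sub, ← h1,
    Finset.sum_sub_distrib, smul_sub]
  abel

/-- The factor b serves two weights: j + 1 in the maximum norm estimate and k⁻¹ in the mean square
estimate. -/
theorem gridErr_succ_sub (hc : 0 < c) (hlam : ∀ n, c ≤ lam n)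
    (hS : ∀ y ∈ S, coeff e y ∈ Hdot lam 1) (hk : 0 < k) (hx : x ∈ Hdot lam (-1)) (j : ℕ) (b : ℝ) :
    b • (gridErr e lam S k x (j + 1) - gridErr e lam S k x j) =
      consistErr e lam S (fun n => b * (primCoeff (lam n) k (j + 1) - primCoeff (lam n) k j))
        (fun n => b * (quadCoeff (lam n) k (j + 1) - quadCoeff (lam n) k j)) x := by
  have hpos : ∀ n, 0 < lam n := fun n => hc.trans_le (hlam n)
  have hp := primCoeff_mul_mem hpos hx hk
  have hq := fun j => mem_Hdot_zero (lam := lam).mpr (quadCoeff_mul_summable hc hlam hx hk j)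
  rw [gridErr, gridErr, consistErr_sub hc hlam hS (hp _) (hp _) (mem_Hdot_zero.mp (hq _))
    (mem_Hdot_zero.mp (hq _)), consistErr_smul hc hlam hS]
  · simpa only [sub_mul] using Hdot_sub hpos (hp (j + 1)) (hp j)
  · have := Hdot_sub hpos (hq (j + 1)) (hq j)
    simpa only [sub_mul] using mem_Hdot_zero.mp this

/-- A multiplier between 0 and λ⁻¹ gains two orders, from Ḣ^(-ρ) to Ḣ^(2-ρ), where the approximation
bound applies. -/
theorem norm_consistErr_le_of_bounds {S : Submodule ℝ H} (hlam : ∀ n, 0 < lam n) (hδ : 0 ≤ δ)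
    {κ : ℝ} (hκ : 0 ≤ κ)
    (hR : ∀ y ∈ Hdot lam (2 - ρ),
      ‖(ritz e lam S y : H) - toH e y‖ ≤ δ * hdotNorm lam (2 - ρ) y)
    (hx : x ∈ Hdot lam (-ρ)) {a d : ι → ℝ} (ha : ∀ n, 0 ≤ a n ∧ a n ≤ (lam n)⁻¹)
    (hd : ∀ n, d n ^ 2 ≤ κ ^ 2 * lam n ^ (-ρ)) :
    ‖consistErr e lam S a d x‖ ≤ (δ + κ) * hdotNorm lam (-ρ) x := by
  have ha' : ∀ n, lam n ^ (2 - ρ) * a n ^ 2 ≤ 1 ^ 2 * lam n ^ (-ρ) := fun n => by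
    have := rpow_mul_sq_le (r := 2 - ρ) (hlam n) (ha n).1 (ha n).2
    rwa [sub_sub_cancel_left] at this
  have hd' : ∀ n, lam n ^ (0 : ℝ) * d n ^ 2 ≤ κ ^ 2 * lam n ^ (-ρ) := by simpa using hd
  have h := norm_consistErr_le (e := e) hR (mul_mem_Hdot hlam ha' hx)
    (mem_Hdot_zero.mp (mul_mem_Hdot hlam hd' hx))
  have h1 := mul_le_mul_of_nonneg_left (hdotNorm_mul_le hlam zero_le_one ha' hx) hδ
  have h2 := hdotNorm_mul_le hlam hκ hd' hx
  linarith

/-- The error of the sums of the Euler approximations, for rough initial values. -/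
theorem norm_sum_error_le (hc : 0 < c) (hlam : ∀ n, c ≤ lam n)
    (hS : ∀ y ∈ S, coeff e y ∈ Hdot lam 1) (hk : 0 < k) (hρ : ρ ∈ Set.Icc (0 : ℝ) 1) (hδ : 0 ≤ δ)
    (hR : ∀ y ∈ Hdot lam (2 - ρ),
      ‖(ritz e lam S y : H) - toH e y‖ ≤ δ * hdotNorm lam (2 - ρ) y)
    (hx : x ∈ Hdot lam (-ρ)) (N : ℕ) :
    ‖k • ∑ i ∈ Finset.range N,
        ((eulerSeq e lam S k x (i + 1) : H) - gridSol e lam k x (i + 1))‖ ≤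
      4 * ((δ + k ^ ((2 - ρ) / 2)) * hdotNorm lam (-ρ) x) := by
  have hpos : ∀ n, 0 < lam n := fun n => hc.trans_le (hlam n)
  have hx1 : x ∈ Hdot lam (-1) := Hdot_mono hc hlam (by linarith [hρ.2]) hx
  have hκ : 0 ≤ k ^ ((2 - ρ) / 2) := Real.rpow_nonneg hk.le _
  refine norm_le_of_euler (T := solutionOp S hc hlam hS) (solutionOp_symmetric hc hlam hS)
    (solutionOp_nonneg hc hlam hS) hk (G := gridErr e lam S k x)
    (w := fun N => k • ∑ i ∈ Finset.range N,
        ((eulerSeq e lam S k x (i + 1) : H) - gridSol e lam k x (i + 1)))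
    (by simp) (fun j => ?_) (fun j => ?_) (fun j => ?_) N
  · rw [← smul_sub, Finset.sum_range_succ_sub_sum, map_smul, ← smul_add,
      solutionOp_error hc hlam hS hk hx1 _ (summable_gridSol_succ hpos hx1 hk j), sub_add_cancel]
  · exact norm_consistErr_le_of_bounds hpos hδ hκ hR hx
      (fun n => primCoeff_bounds (hpos n) hk.le j) fun n => quadCoeff_sq_le (hpos n) hk hρ j
  · have hj : (0 : ℝ) ≤ j + 1 := by positivity
    have h := congrArg norm (gridErr_succ_sub hc hlam hS hk hx1 j (j + 1))
    rw [norm_smul, Real.norm_of_nonneg hj] at h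
    rw [h]
    exact norm_consistErr_le_of_bounds hpos hδ hκ hR hx
      (fun n => succ_mul_primCoeff_sub_bounds (hpos n) hk.le j)
      fun n => succ_mul_quadCoeff_sub_sq_le (hpos n) hk hρ j

theorem toH_quadCoeffAt (hc : 0 < c) (hlam : ∀ n, c ≤ lam n) (hx : x ∈ Hdot lam (-1))
    (hk : 0 < k) {t : ℝ} (ht : 0 ≤ t) : toH e (fun n => quadCoeffAt (lam n) k t * x n) =
      toH e (fun n => (lam n)⁻¹ * (1 - Real.exp (-lam n * t)) * x n) -
        (k • ∑ i ∈ Finset.range ⌊t / k⌋₊, gridSol e lam k x (i + 1) +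
          (t - ⌊t / k⌋₊ * k) • gridSol e lam k x (⌊t / k⌋₊ + 1)) := by
  have hpos : ∀ n, 0 < lam n := fun n => hc.trans_le (hlam n)
  have hs := fun i => hasSum_toH (e := e) (summable_gridSol_succ hpos hx hk i)
  have h1 := hasSum_toH (e := e) (mem_Hdot_zero.mp (Hdot_mono hc hlam zero_le_one
    (mul_mem_Hdot_one hpos hx fun n => prim_bounds (hpos n) ht)))
  have h2 := h1.sub (((hasSum_sum (s := Finset.range ⌊t / k⌋₊) fun i _ => hs i).const_smul k).add
    ((hs ⌊t / k⌋₊).const_smul (t - ⌊t / k⌋₊ * k)))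
  refine HasSum.tsum_eq (h2.congr_fun fun n => ?_)
  beta_reduce
  rw [← Finset.sum_smul, smul_smul, smul_smul, ← add_smul, ← sub_smul, quadCoeffAt,
    ← Finset.sum_mul]
  ring_nf

/-- The error of the integrals, for rough initial values. -/
theorem integral_errorOp_le [CompleteSpace H] [Countable ι] (hc : 0 < c) (hlam : ∀ n, c ≤ lam n)
    (hS : ∀ y ∈ S, coeff e y ∈ Hdot lam 1) (hk : 0 < k) (hρ : ρ ∈ Set.Icc (0 : ℝ) 1) (hδ : 0 ≤ δ)
    (hR : ∀ y ∈ Hdot lam (2 - ρ),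
      ‖(ritz e lam S y : H) - toH e y‖ ≤ δ * hdotNorm lam (2 - ρ) y)
    (hx : x ∈ Hdot lam (-ρ)) {t : ℝ} (ht : 0 < t) :
    IntervalIntegrable (fun σ => errorOp e lam S k σ x) volume 0 t ∧
      ‖∫ σ in (0 : ℝ)..t, errorOp e lam S k σ x‖ ≤
        (4 * δ + 5 * k ^ ((2 - ρ) / 2)) * hdotNorm lam (-ρ) x := by
  have hpos : ∀ n, 0 < lam n := fun n => hc.trans_le (hlam n)
  have hx1 : x ∈ Hdot lam (-1) := Hdot_mono hc hlam (by linarith [hρ.2]) hx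
  have hκ : 0 ≤ k ^ ((2 - ρ) / 2) := Real.rpow_nonneg hk.le _
  obtain ⟨i1, e1⟩ := integral_step hk (fun j => (eulerSeq e lam S k x (j + 1) : H)) ht.le
  have i2 := intervalIntegrable_semigroup (e := e) hpos hx1 ht.le
  refine ⟨i1.sub i2, ?_⟩
  have hint : ∫ σ in (0 : ℝ)..t, errorOp e lam S k σ x =
      (∫ σ in (0 : ℝ)..t, (eulerSeq e lam S k x (⌊σ / k⌋₊ + 1) : H)) -
        ∫ σ in (0 : ℝ)..t, semigroup e lam σ x :=
    intervalIntegral.integral_sub i1 i2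
  set w : ℕ → H := fun N => k • ∑ i ∈ Finset.range N,
    ((eulerSeq e lam S k x (i + 1) : H) - gridSol e lam k x (i + 1)) with hw
  have hwN : ∀ N, ‖w N‖ ≤ _ := norm_sum_error_le hc hlam hS hk hρ hδ hR hx
  obtain ⟨hn1, hn2⟩ := mem_Ico_floor hk ht.le
  set m := ⌊t / k⌋₊ with hm
  -- The discrete integral of e is piecewise linear in t, so the grid bound passes to the convex
  -- combination of w_m and w_{m+1}. What remains is the quadrature error cut off at t, which
  -- accounts for 5 = 4 + 1.
  set θ := (t - m * k) / k with hθ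
  have hθ0 : 0 ≤ θ := div_nonneg (by linarith) hk.le
  have hθ1 : θ ≤ 1 := (div_le_one hk).mpr (by linarith)
  have hθk : θ * k = t - m * k := div_mul_cancel₀ _ hk.ne'
  have hd : ∀ n, lam n ^ (0 : ℝ) * quadCoeffAt (lam n) k t ^ 2 ≤
      (k ^ ((2 - ρ) / 2)) ^ 2 * lam n ^ (-ρ) := fun n => by
    simpa using quadCoeffAt_sq_le (hpos n) hk hρ ht.le
  have hq := toH_quadCoeffAt (e := e) hc hlam hx1 hk ht.le
  have hqn := norm_toH (e := e) (lam := lam) (mem_Hdot_zero.mp (mul_mem_Hdot hpos hd hx))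
  have hqn' := hdotNorm_mul_le hpos hκ hd hx
  have hmain : ∫ σ in (0 : ℝ)..t, errorOp e lam S k σ x =
      (1 - θ) • w m + θ • w (m + 1) - toH e (fun n => quadCoeffAt (lam n) k t * x n) := by
    rw [hint, e1, integral_semigroup hc hlam hx1 ht.le, hq]
    simp only [hw, ← hm]
    rw [Finset.sum_range_succ _ m, smul_add k, smul_add θ, smul_smul θ k (_ - _), hθk,
      Finset.sum_sub_distrib]
    module
  rw [hmain]
  have b1 : ‖(1 - θ) • w m‖ ≤ (1 - θ) * (4 * ((δ + k ^ ((2 - ρ) / 2)) * hdotNorm lam (-ρ) x)) := by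
    rw [norm_smul, Real.norm_of_nonneg (by linarith)]
    exact mul_le_mul_of_nonneg_left (hwN m) (by linarith)
  have b2 : ‖θ • w (m + 1)‖ ≤ θ * (4 * ((δ + k ^ ((2 - ρ) / 2)) * hdotNorm lam (-ρ) x)) := by
    rw [norm_smul, Real.norm_of_nonneg hθ0]
    exact mul_le_mul_of_nonneg_left (hwN _) hθ0
  have b3 := norm_sub_le ((1 - θ) • w m + θ • w (m + 1))
    (toH e (fun n => quadCoeffAt (lam n) k t * x n))
  have b4 := norm_add_le ((1 - θ) • w m) (θ • w (m + 1))
  linarith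

end ErrorEstimates

/-! ### Scalar square sums of the residual increments. -/

section SquareScalar

variable {l k ρ : ℝ}

/-- The factor outside the sum of squared decrements is k⁻² l^(ρ-1), and that sum is at most kl. The
remaining k⁻¹ cancels against the step length in the time integral. -/
theorem sum_primCoeff_sub_sq_le (hl : 0 < l) (hk : 0 < k) (N : ℕ) :
    ∑ j ∈ Finset.range N, l ^ (1 + ρ) * (k⁻¹ * (primCoeff l k (j + 1) - primCoeff l k j)) ^ 2
      ≤ k⁻¹ * l ^ ρ := by
  have h1 := sum_increment_sq_le hl hk.le N
  have h2 := one_sub_exp_le hl hk (ρ := 1) (by norm_num)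
  rw [Real.rpow_one, Real.rpow_one] at h2
  have h3 : ∀ j, l ^ (1 + ρ) * (k⁻¹ * (primCoeff l k (j + 1) - primCoeff l k j)) ^ 2 =
      k⁻¹ ^ 2 * l⁻¹ * l ^ ρ * (Real.exp (-l * k) ^ j - Real.exp (-l * k) ^ (j + 1)) ^ 2 := by
    intro j
    rw [primCoeff_succ_sub, Real.rpow_add hl, Real.rpow_one]
    field_simp
  simp only [h3, ← Finset.mul_sum]
  have h4 : 0 ≤ k⁻¹ ^ 2 * l⁻¹ * l ^ ρ := by positivity
  refine (mul_le_mul_of_nonneg_left (h1.trans h2) h4).trans (le_of_eq ?_)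
  field_simp

theorem sum_increment_sq_le_rpow (hl : 0 < l) (hk : 0 < k) (hρ : ρ ∈ Set.Icc (0 : ℝ) 1) (N : ℕ) :
    ∑ j ∈ Finset.range N,
      l ^ (0 : ℝ) * (Real.exp (-l * k) ^ j - Real.exp (-l * k) ^ (j + 1)) ^ 2 ≤ k ^ ρ * l ^ ρ := by
  simpa using (sum_increment_sq_le hl hk.le N).trans (one_sub_exp_le hl hk hρ)

theorem sum_quadCoeff_sub_sq_le (hl : 0 < l) (hk : 0 < k) (hρ : ρ ∈ Set.Icc (0 : ℝ) 1) (N : ℕ) :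
    ∑ j ∈ Finset.range N,
      l ^ (0 : ℝ) * (k⁻¹ * (quadCoeff l k (j + 1) - quadCoeff l k j)) ^ 2 ≤ k ^ ρ * l ^ ρ := by
  refine le_trans (Finset.sum_le_sum fun j _ => ?_) (sum_increment_sq_le_rpow hl hk hρ N)
  have h := quadCoeff_increment_bounds hl k j
  have h1 := inv_pos.mpr hk
  refine mul_le_mul_of_nonneg_left (pow_le_pow_left₀ (mul_nonneg h1.le h.1) ?_ 2)
    (Real.rpow_nonneg hl.le _)
  exact (inv_mul_le_iff₀ hk).mpr h.2

end SquareScalar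

/-! ### The mean square error. -/

section SquareErrorEstimates

variable {H : Type*} [NormedAddCommGroup H] [InnerProductSpace ℝ H] {ι : Type*}
  {e : HilbertBasis ι ℝ H} {lam : ι → ℝ} {x : ι → ℝ} {c k ρ δ : ℝ}

theorem mul_mem_Hdot_of_sum (hlam : ∀ n, 0 < lam n) {r r' K : ℝ} {m : ℕ → ι → ℝ}
    (hm : ∀ n N, ∑ j ∈ Finset.range N, lam n ^ r * m j n ^ 2 ≤ K * lam n ^ r')
    (hx : x ∈ Hdot lam r') (j : ℕ) : (fun n => m j n * x n) ∈ Hdot lam r :=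
  mul_mem_Hdot hlam (fun n => (Finset.single_le_sum (f := fun j => lam n ^ r * m j n ^ 2)
    (fun _ _ => mul_nonneg (Real.rpow_nonneg (hlam n).le _) (sq_nonneg _))
    (Finset.self_mem_range_succ j)).trans (hm n (j + 1))) hx

theorem sum_norm_gridErr_sub_sq_le {S : Submodule ℝ H} [FiniteDimensional ℝ S] (hc : 0 < c)
    (hlam : ∀ n, c ≤ lam n)
    (hS : ∀ y ∈ S, coeff e y ∈ Hdot lam 1) (hk : 0 < k) (hρ : ρ ∈ Set.Icc (0 : ℝ) 1)
    (hR : ∀ y ∈ Hdot lam (1 + ρ),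
      ‖(ritz e lam S y : H) - toH e y‖ ≤ δ * hdotNorm lam (1 + ρ) y)
    (hx : x ∈ Hdot lam ρ) (N : ℕ) :
    ∑ j ∈ Finset.range N,
        ‖k⁻¹ • (gridErr e lam S k x (j + 1) - gridErr e lam S k x j)‖ ^ 2 ≤
      (2 * δ ^ 2 * k⁻¹ + 2 * k ^ ρ) * hdotNorm lam ρ x ^ 2 := by
  have hpos : ∀ n, 0 < lam n := fun n => hc.trans_le (hlam n)
  have hx1 : x ∈ Hdot lam (-1) := Hdot_mono hc hlam (by linarith [hρ.1]) hx
  have ha := fun n N => sum_primCoeff_sub_sq_le (ρ := ρ) (hpos n) hk N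
  have hd := fun n N => sum_quadCoeff_sub_sq_le (hpos n) hk hρ N
  have sa := sum_hdotNorm_sq_le hpos (fun n => ha n N) hx
  have sd := sum_hdotNorm_sq_le hpos (fun n => hd n N) hx
  refine le_trans (Finset.sum_le_sum (g := fun j =>
    2 * δ ^ 2 * hdotNorm lam (1 + ρ) (fun n =>
      k⁻¹ * (primCoeff (lam n) k (j + 1) - primCoeff (lam n) k j) * x n) ^ 2 +
    2 * hdotNorm lam 0 (fun n =>
      k⁻¹ * (quadCoeff (lam n) k (j + 1) - quadCoeff (lam n) k j) * x n) ^ 2) fun j _ => ?_) ?_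
  · rw [gridErr_succ_sub hc hlam hS hk hx1]
    have h := norm_consistErr_le (e := e) hR (mul_mem_Hdot_of_sum hpos ha hx j)
      (mem_Hdot_zero.mp (mul_mem_Hdot_of_sum hpos hd hx j))
    refine (pow_le_pow_left₀ (norm_nonneg _) h 2).trans (add_sq_le.trans (le_of_eq ?_))
    ring
  · rw [Finset.sum_add_distrib, ← Finset.mul_sum, ← Finset.mul_sum]
    have := mul_le_mul_of_nonneg_left sa (by positivity : 0 ≤ 2 * δ ^ 2)
    linarith

/-- The mean square error at the grid points, for smooth initial values. -/
theorem sum_sq_error_le {S : Submodule ℝ H} [FiniteDimensional ℝ S] (hc : 0 < c)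
    (hlam : ∀ n, c ≤ lam n)
    (hS : ∀ y ∈ S, coeff e y ∈ Hdot lam 1) (hk : 0 < k) (hρ : ρ ∈ Set.Icc (0 : ℝ) 1)
    (hR : ∀ y ∈ Hdot lam (1 + ρ),
      ‖(ritz e lam S y : H) - toH e y‖ ≤ δ * hdotNorm lam (1 + ρ) y)
    (hx : x ∈ Hdot lam ρ) (N : ℕ) :
    ∑ j ∈ Finset.range N,
        ‖(eulerSeq e lam S k x (j + 1) : H) - gridSol e lam k x (j + 1)‖ ^ 2 ≤
      (2 * δ ^ 2 * k⁻¹ + 2 * k ^ ρ) * hdotNorm lam ρ x ^ 2 := by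
  have hpos : ∀ n, 0 < lam n := fun n => hc.trans_le (hlam n)
  have hx1 : x ∈ Hdot lam (-1) := Hdot_mono hc hlam (by linarith [hρ.1]) hx
  have hx0 : Summable fun n => (Real.exp (-lam n * k) ^ 0 * x n) ^ 2 := by
    simpa using mem_Hdot_zero.mp (Hdot_mono hc hlam hρ.1 hx)
  have hj : ∀ j, Summable fun n => (Real.exp (-lam n * k) ^ j * x n) ^ 2 := fun j => by
    cases j with
    | zero => exact hx0
    | succ j => exact summable_gridSol_succ hpos hx1 hk j
  refine le_trans (sum_norm_sq_le_of_euler (T := solutionOp S hc hlam hS)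
    (solutionOp_symmetric hc hlam hS) (solutionOp_nonneg hc hlam hS) hk
    (w := fun j => (eulerSeq e lam S k x j : H) - gridSol e lam k x j)
    (g := fun j => k⁻¹ • (gridErr e lam S k x (j + 1) - gridErr e lam S k x j))
    ?_ (fun j => ?_) N) (sum_norm_gridErr_sub_sq_le hc hlam hS hk hρ hR hx N)
  -- T annihilates the initial error P_h x - x, because T P_h x and T x both equal R_h A⁻¹x.
  · have h : solutionOp S hc hlam hS (gridSol e lam k x 0) =
        ritz e lam S (fracPow lam (-1) x) := by
      change (ritz e lam S (fracPow lam (-1) (coeff e (gridSol e lam k x 0))) : H) = _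
      rw [gridSol, coeff_toH hx0]
      simp
    rw [map_sub, h, eulerSeq, pow_zero, Module.End.one_apply, solutionOp_genProj, sub_self]
  -- Subtracting consecutive error equations leaves only the term k e_{j+1} of the sums.
  · rw [map_sub, solutionOp_error hc hlam hS hk hx1 _ (hj _),
      solutionOp_error hc hlam hS hk hx1 _ (hj _), smul_inv_smul₀ hk.ne', Finset.sum_range_succ,
      smul_add]
    abel

theorem hdotNorm_le_of_sq_le (hlam : ∀ n, 0 < lam n) {r : ℝ} {x y : ι → ℝ}
    (h : ∀ n, x n ^ 2 ≤ y n ^ 2) (hy : y ∈ Hdot lam r) : hdotNorm lam r x ≤ hdotNorm lam r y := by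
  have h1 : ∀ n, lam n ^ r * x n ^ 2 ≤ lam n ^ r * y n ^ 2 := fun n =>
    mul_le_mul_of_nonneg_left (h n) (Real.rpow_nonneg (hlam n).le _)
  refine Real.sqrt_le_sqrt (Summable.tsum_le_tsum h1 (Summable.of_nonneg_of_le (fun n => ?_) h1 hy)
    hy)
  exact mul_nonneg (Real.rpow_nonneg (hlam n).le _) (sq_nonneg _)

/-- The exact solution varies on a time step at most by its increment over the step. -/
theorem norm_gridSol_sub_semigroup_le (hc : 0 < c) (hlam : ∀ n, c ≤ lam n) (hk : 0 < k)
    (hx : x ∈ Hdot lam 0) {σ : ℝ} (hσ : 0 < σ) :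
    ‖gridSol e lam k x (⌊σ / k⌋₊ + 1) - semigroup e lam σ x‖ ≤
      hdotNorm lam 0 fun n => (Real.exp (-lam n * k) ^ ⌊σ / k⌋₊ -
        Real.exp (-lam n * k) ^ (⌊σ / k⌋₊ + 1)) * x n := by
  have hpos : ∀ n, 0 < lam n := fun n => hc.trans_le (hlam n)
  have hx1 : x ∈ Hdot lam (-1) := Hdot_mono hc hlam (by norm_num) hx
  have hs1 := summable_gridSol_succ hpos hx1 hk ⌊σ / k⌋₊
  have hs2 := summable_semigroup hpos hx1 hσ
  have hsub : Summable fun n => (Real.exp (-lam n * k) ^ (⌊σ / k⌋₊ + 1) * x n -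
      Real.exp (-lam n * σ) * x n) ^ 2 :=
    mem_Hdot_zero.mp (Hdot_sub hpos (mem_Hdot_zero (lam := lam).mpr hs1)
      (mem_Hdot_zero (lam := lam).mpr hs2))
  obtain ⟨hn1, hn2⟩ := mem_Ico_floor hk hσ.le
  set m := ⌊σ / k⌋₊
  rw [gridSol, semigroup, ← toH_sub hs1 hs2, norm_toH (lam := lam) hsub]
  refine hdotNorm_le_of_sq_le hpos (fun n => ?_) ?_
  · have h1 : Real.exp (-lam n * σ) ≤ Real.exp (-lam n * k) ^ m := by
      rw [← exp_mul_nat]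
      exact Real.exp_le_exp.mpr (by nlinarith [hpos n])
    have h2 : Real.exp (-lam n * k) ^ (m + 1) ≤ Real.exp (-lam n * σ) := by
      rw [← exp_mul_nat]
      push_cast
      exact Real.exp_le_exp.mpr (by nlinarith [hpos n])
    rw [← sub_mul, mul_pow, mul_pow]
    refine mul_le_mul_of_nonneg_right (sq_le_sq.mpr ?_) (sq_nonneg _)
    rw [abs_sub_comm, abs_of_nonneg (by linarith), abs_of_nonneg (by linarith)]
    linarith
  · exact mul_mem_Hdot_of_sum hpos (m := fun j n => Real.exp (-lam n * k) ^ j -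
      Real.exp (-lam n * k) ^ (j + 1)) (fun n N => sum_increment_sq_le_rpow (hpos n) hk
        (ρ := 0) (by norm_num) N) hx m

/-- The mean square error, for smooth initial values. -/
theorem integral_sq_errorOp_le {S : Submodule ℝ H} [FiniteDimensional ℝ S] [CompleteSpace H]
    [Countable ι] (hc : 0 < c) (hlam : ∀ n, c ≤ lam n)
    (hS : ∀ y ∈ S, coeff e y ∈ Hdot lam 1) (hk : 0 < k) (hρ : ρ ∈ Set.Icc (0 : ℝ) 1) (hδ : 0 ≤ δ)
    (hR : ∀ y ∈ Hdot lam (1 + ρ),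
      ‖(ritz e lam S y : H) - toH e y‖ ≤ δ * hdotNorm lam (1 + ρ) y)
    (hx : x ∈ Hdot lam ρ) {t : ℝ} (ht : 0 < t) :
    IntervalIntegrable (fun σ => ‖errorOp e lam S k σ x‖ ^ 2) volume 0 t ∧
      √(∫ σ in (0 : ℝ)..t, ‖errorOp e lam S k σ x‖ ^ 2) ≤
        (2 * δ + 3 * k ^ ((1 + ρ) / 2)) * hdotNorm lam ρ x := by
  have hpos : ∀ n, 0 < lam n := fun n => hc.trans_le (hlam n)
  have hx0 : x ∈ Hdot lam 0 := Hdot_mono hc hlam hρ.1 hx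
  have hx1 : x ∈ Hdot lam (-1) := Hdot_mono hc hlam (by norm_num) hx0
  have hκ : 0 ≤ k ^ ((1 + ρ) / 2) := Real.rpow_nonneg hk.le _
  have hκ2 : (k ^ ((1 + ρ) / 2)) ^ 2 = k * k ^ ρ := by
    rw [← Real.rpow_mul_natCast hk.le, ← Real.rpow_one_add' hk.le (by linarith [hρ.1])]
    congr 1
    push_cast
    ring
  set X := hdotNorm lam ρ x with hX
  have hX0 : 0 ≤ X := hdotNorm_nonneg
  set D : ℕ → ℝ := fun j => hdotNorm lam 0 fun n => (Real.exp (-lam n * k) ^ j -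
        Real.exp (-lam n * k) ^ (j + 1)) * x n with hD
  set g : ℕ → ℝ := fun j => 2 * ‖(eulerSeq e lam S k x (j + 1) : H) -
    gridSol e lam k x (j + 1)‖ ^ 2 + 2 * D j ^ 2 with hg
  have hg0 : ∀ j, 0 ≤ g j := fun j => by positivity
  have hle : ∀ σ ∈ Set.Ioc 0 t, ‖errorOp e lam S k σ x‖ ^ 2 ≤ g ⌊σ / k⌋₊ := by
    intro σ hσ
    have h1 := norm_gridSol_sub_semigroup_le (e := e) hc hlam hk hx0 hσ.1
    have h2 : errorOp e lam S k σ x = (eulerSeq e lam S k x (⌊σ / k⌋₊ + 1) -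
        gridSol e lam k x (⌊σ / k⌋₊ + 1)) +
        (gridSol e lam k x (⌊σ / k⌋₊ + 1) - semigroup e lam σ x) := by
      rw [sub_add_sub_cancel]
      rfl
    have h3 := (norm_add_le _ _).trans (add_le_add_right h1 ‖(eulerSeq e lam S k x (⌊σ / k⌋₊ + 1) -
        gridSol e lam k x (⌊σ / k⌋₊ + 1) : H)‖)
    rw [← h2] at h3
    refine (pow_le_pow_left₀ (norm_nonneg _) h3 2).trans (add_sq_le.trans (le_of_eq ?_))
    simp only [hg, hD]
    ring
  obtain ⟨i1, e1⟩ := integral_step hk g ht.le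
  have hF : IntervalIntegrable (fun σ => errorOp e lam S k σ x) volume 0 t :=
    (integral_step hk (fun j => (eulerSeq e lam S k x (j + 1) : H)) ht.le).1.sub
      (intervalIntegrable_semigroup hpos hx1 ht.le)
  have hi : IntervalIntegrable (fun σ => ‖errorOp e lam S k σ x‖ ^ 2) volume 0 t := by
    refine i1.mono_fun' ?_ ?_ <;> rw [Set.uIoc_of_le ht.le]
    · exact hF.1.aestronglyMeasurable.norm.pow 2
    refine (ae_restrict_iff' measurableSet_Ioc).mpr (Filter.Eventually.of_forall fun σ hσ => ?_)
    simp only [norm_pow, norm_norm]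
    exact hle σ hσ
  refine ⟨hi, ?_⟩
  have hint := intervalIntegral.integral_mono_on_of_le_Ioo ht.le hi i1
    fun σ hσ => hle σ (Set.Ioo_subset_Ioc_self hσ)
  -- Since g is nonnegative, the last, cut-off interval may be extended to a full step.
  have hsum : ∫ σ in (0 : ℝ)..t, g ⌊σ / k⌋₊ ≤ k * ∑ j ∈ Finset.range (⌊t / k⌋₊ + 1), g j := by
    rw [e1, Finset.sum_range_succ, mul_add, smul_eq_mul, smul_eq_mul]
    have := (mem_Ico_floor hk ht.le).2
    have := mul_le_mul_of_nonneg_right (by linarith : t - ⌊t / k⌋₊ * k ≤ k) (hg0 ⌊t / k⌋₊)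
    linarith
  have s1 := sum_sq_error_le hc hlam hS hk hρ hR hx (⌊t / k⌋₊ + 1)
  have s2 : ∑ j ∈ Finset.range (⌊t / k⌋₊ + 1), D j ^ 2 ≤ k ^ ρ * X ^ 2 :=
    sum_hdotNorm_sq_le hpos (fun n => sum_increment_sq_le_rpow (hpos n) hk hρ _) hx
  have hsum2 : k * ∑ j ∈ Finset.range (⌊t / k⌋₊ + 1), g j ≤
      (4 * δ ^ 2 + 6 * (k ^ ((1 + ρ) / 2)) ^ 2) * X ^ 2 := by
    simp only [hg]
    rw [Finset.sum_add_distrib, ← Finset.mul_sum, ← Finset.mul_sum, hκ2]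
    have h1 := mul_le_mul_of_nonneg_left s1 hk.le
    have h2 := mul_le_mul_of_nonneg_left s2 hk.le
    have h3 : k * ((2 * δ ^ 2 * k⁻¹ + 2 * k ^ ρ) * X ^ 2) =
        2 * δ ^ 2 * X ^ 2 + 2 * (k * k ^ ρ) * X ^ 2 := by
      field_simp
    rw [← hX, h3] at h1
    linarith
  refine Real.sqrt_le_iff.mpr ⟨by positivity, (hint.trans (hsum.trans hsum2)).trans ?_⟩
  rw [mul_pow]
  refine mul_le_mul_of_nonneg_right ?_ (sq_nonneg _)
  -- With κ = k^((1+ρ)/2), this is 4δ² + 6κ² ≤ (2δ + 3κ)².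
  nlinarith [mul_nonneg hδ hκ, sq_nonneg (k ^ ((1 + ρ) / 2))]

end SquareErrorEstimates

/-! ### Lower bound for the spectrum, uniform approximation constant, and conclusion. -/

theorem IsPosDefWithCompactInverse.exists_le_eigenvalue {H : Type*} [NormedAddCommGroup H]
    [InnerProductSpace ℝ H] [CompleteSpace H] {A : H →ₗ.[ℝ] H}
    (hA : IsPosDefWithCompactInverse A) {ι : Type*} {e : HilbertBasis ι ℝ H} {lam : ι → ℝ}
    (he : IsEigenbasis A e lam) : ∃ c : ℝ, 0 < c ∧ ∀ n, c ≤ lam n := by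
  obtain ⟨T, -, -, hT⟩ := hA.compact_inverse
  -- From λ T e_n = e_n one gets 1 ≤ λ‖T‖; the added 1 keeps the witness positive when T = 0, as on
  -- the zero space.
  refine ⟨(‖T‖ + 1)⁻¹, by positivity, fun n => ?_⟩
  have hl := hA.eigenvalue_pos he n
  obtain ⟨hn, h⟩ := he n
  have h1 := hT ⟨e n, hn⟩
  rw [h, map_smul] at h1
  have h2 : ‖e n‖ = 1 := e.orthonormal.1 n
  have h3 := T.le_opNorm (e n)
  have h4 := congrArg norm h1
  rw [norm_smul, Real.norm_of_nonneg hl.le] at h4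
  simp only [h2, mul_one] at h3 h4
  rw [inv_le_iff_one_le_mul₀ (by positivity)]
  nlinarith

theorem ApproximationProperty.exists_interpolated {H : Type*} [NormedAddCommGroup H]
    [InnerProductSpace ℝ H] {ι : Type*} {e : HilbertBasis ι ℝ H} {lam : ι → ℝ}
    {S : ℝ → Submodule ℝ H} (hS_approx : ApproximationProperty e lam S)
    (hS : IsGalerkinFamily e lam S) {c : ℝ} (hc : 0 < c) (hlam : ∀ n, c ≤ lam n) :
    ∃ C : ℝ, 0 ≤ C ∧ ∀ h ∈ Set.Ioc (0 : ℝ) 1, ∀ s ∈ Set.Icc (1 : ℝ) 2, ∀ x ∈ Hdot lam s,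
      ‖(ritz e lam (S h) x : H) - toH e x‖ ≤ C * h ^ s * hdotNorm lam s x := by
  obtain ⟨C, hC⟩ := hS_approx
  refine ⟨2 * |C|, by positivity, fun h hh s hs x hx => ?_⟩
  have := (hS h hh).1
  have key : ∀ s ∈ ({1, 2} : Set ℝ), ∀ x ∈ Hdot lam s,
      ‖(ritz e lam (S h) x : H) - toH e x‖ ≤ |C| * h ^ s * hdotNorm lam s x := fun s hs x hx =>
    (hC h hh s hs x hx).trans (mul_le_mul_of_nonneg_right (mul_le_mul_of_nonneg_right
      (le_abs_self C) (Real.rpow_nonneg hh.1.le _)) hdotNorm_nonneg)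
  refine approximation_interpolated hc hlam (hS h hh).2 (abs_nonneg C) hh.1 (fun x hx => ?_)
    (fun x hx => ?_) hs hx
  · simpa using key 1 (by simp) x hx
  · simpa using key 2 (by simp) x hx

end GalerkinEuler

end

theorem mainTheorem4 {H : Type*} [NormedAddCommGroup H] [InnerProductSpace ℝ H] [CompleteSpace H]
    [TopologicalSpace.SeparableSpace H]
    (A : H →ₗ.[ℝ] H) (hA : GalerkinEuler.IsPosDefWithCompactInverse A)
    {ι : Type*} (e : HilbertBasis ι ℝ H) (lam : ι → ℝ) (he : GalerkinEuler.IsEigenbasis A e lam)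
    (S : ℝ → Submodule ℝ H) (hS : GalerkinEuler.IsGalerkinFamily e lam S)
    (hS_approx : GalerkinEuler.ApproximationProperty e lam S)
    (ρ : ℝ) (hρ : ρ ∈ Set.Icc (0 : ℝ) 1) :
    (∃ C : ℝ, ∀ x ∈ GalerkinEuler.Hdot lam (-ρ), ∀ t : ℝ, 0 < t →
      ∀ h ∈ Set.Ioc (0 : ℝ) 1, ∀ k ∈ Set.Ioc (0 : ℝ) 1,
        IntervalIntegrable (fun σ => GalerkinEuler.errorOp e lam (S h) k σ x) volume 0 t ∧
        ‖∫ σ in (0 : ℝ)..t, GalerkinEuler.errorOp e lam (S h) k σ x‖ ≤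
          C * (h ^ (2 - ρ) + k ^ ((2 - ρ) / 2)) * GalerkinEuler.hdotNorm lam (-ρ) x) ∧
    (GalerkinEuler.ProjectionStability e lam S →
      ∃ C : ℝ, ∀ x ∈ GalerkinEuler.Hdot lam ρ, ∀ t : ℝ, 0 < t →
        ∀ h ∈ Set.Ioc (0 : ℝ) 1, ∀ k ∈ Set.Ioc (0 : ℝ) 1,
          IntervalIntegrable (fun σ => ‖GalerkinEuler.errorOp e lam (S h) k σ x‖ ^ 2) volume 0 t ∧
          √(∫ σ in (0 : ℝ)..t, ‖GalerkinEuler.errorOp e lam (S h) k σ x‖ ^ 2) ≤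
            C * (h ^ (1 + ρ) + k ^ ((1 + ρ) / 2)) * GalerkinEuler.hdotNorm lam ρ x) := by
  obtain ⟨c, hc, hlam⟩ := hA.exists_le_eigenvalue he
  obtain ⟨C, hC0, hC⟩ := hS_approx.exists_interpolated hS hc hlam
  have := GalerkinEuler.countable_of_hilbertBasis e
  -- The constants come from δ = C h^(2-ρ) and δ = C h^(1+ρ) respectively, with the coefficients of
  -- δ and of the power of k added up.
  refine ⟨⟨4 * C + 5, fun x hx t ht h hh k hk => ?_⟩,
    fun _ => ⟨2 * C + 3, fun x hx t ht h hh k hk => ?_⟩⟩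
  · have := (hS h hh).1
    have hh0 : 0 ≤ h ^ (2 - ρ) := Real.rpow_nonneg hh.1.le _
    have hk0 : 0 ≤ k ^ ((2 - ρ) / 2) := Real.rpow_nonneg hk.1.le _
    obtain ⟨h1, h2⟩ := GalerkinEuler.integral_errorOp_le (e := e) hc hlam (hS h hh).2 hk.1 hρ
      (mul_nonneg hC0 hh0) (hC h hh (2 - ρ) ⟨by linarith [hρ.2], by linarith [hρ.1]⟩) hx ht
    refine ⟨h1, h2.trans (mul_le_mul_of_nonneg_right ?_ GalerkinEuler.hdotNorm_nonneg)⟩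
    linarith [mul_nonneg hC0 hk0]
  · have := (hS h hh).1
    have hh0 : 0 ≤ h ^ (1 + ρ) := Real.rpow_nonneg hh.1.le _
    have hk0 : 0 ≤ k ^ ((1 + ρ) / 2) := Real.rpow_nonneg hk.1.le _
    obtain ⟨h1, h2⟩ := GalerkinEuler.integral_sq_errorOp_le (e := e) hc hlam (hS h hh).2 hk.1 hρ
      (mul_nonneg hC0 hh0) (hC h hh (1 + ρ) ⟨by linarith [hρ.1], by linarith [hρ.2]⟩) hx ht
    refine ⟨h1, h2.trans (mul_le_mul_of_nonneg_right ?_ GalerkinEuler.hdotNorm_nonneg)⟩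
    linarith [mul_nonneg hC0 hk0]
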